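/- Let $n\ge 1$ and $\lambda_1,\dots,\lambda_n\in\mathbb R$. Let $H_{n+1}=\mathbb C^n\times\mathbb R$ with coordinates $(z,x_{2n+1})$, $z_j=x_{2j-1}+ix_{2j}$, carry the CR structure $T^{1,0}H_{n+1}$ spanned over $\mathbb C$ by $$Z_j=\frac{\partial}{\partial z_j}-i\lambda_j\overline z_j\frac{\partial}{\partial x_{2n+1}},\qquad j=1,\dots,n,$$ and the Hermitian metric on $\mathbb C TH_{n+1}$ for which $Z_1,\dots,Z_n,\overline Z_1,\dots,\overline Z_n,T=-\partial/\partial x_{2n+1}$ are orthonormal. Its volume form is $2^n\,dx_1\cdots dx_{2n+1}$, and the forms $d\overline z^J=d\overline z_{j_1}\wedge\dots\wedge d\overline z_{j_q}$, $J=(j_1<\dots<j_q)$, are an orthonormal frame of the bundle of $(0,q)$-forms. Let $L^2_{(0,q)}(H_{n+1})$ be the corresponding space of square integrable $(0,q)$-forms. Let $$\overline\partial_b\Big(\sum_{|J|=q}u_J\,d\overline z^J\Big)=\sum_{|J|=q}\sum_{k=1}^n(\overline Z_ku_J)\,d\overline z_k\wedge d\overline z^J$$ be the tangential Cauchy–Riemann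 operator, extended in the sense of distributions to the domain $\{u\in L^2_{(0,q)}(H_{n+1}):\overline\partial_bu\in L^2_{(0,q+1)}(H_{n+1})\}$, and let $\overline\partial_b^*$ be its Hilbert space adjoint. For $0\le q\le n$ let $\Box_b^{(q)}=\overline\partial_b\overline\partial_b^*+\overline\partial_b^*\overline\partial_b$ be the Kohn Laplacian (Gaffney extension) with domain $$\{u\in\operatorname{Dom}\overline\partial_b\cap\operatorname{Dom}\overline\partial_b^*:\ \overline\partial_bu\in\operatorname{Dom}\overline\partial_b^*,\ \overline\partial_b^*u\in\operatorname{Dom}\overline\partial_b\}\subset L^2_{(0,q)}(H_{n+1}),$$ where for $q=0$ the operator $\overline\partial_b^*$ on functions is zero. Put $\mathcal H^q_b(H_{n+1})=\operatorname{Ker}\Box_b^{(q)}$. 1. If $\lambda_j=0$ for some $j$, then $\mathcal H^q_b(H_{n+1})=\{0\}$ for every $q\in\{0,\dots,n\}$. 2. Suppose that all $\lambda_j$ are non-zero, and let $n_-$ be the number of negative $\lambda_j$ and $n_+$ the number of positive $\lambda_j$. If $q\in\{0,\dots,n\}$ and $q\notin\{n_-,n_+\}$, then $\mathcal H^q_b(H_{n+1})=\{0\}$.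 -/

import Mathlib

open MeasureTheory
open scoped ENNReal ContDiff

noncomputable section

namespace Heisenberg

/-- The Heisenberg group `H_{n+1} = ℂⁿ × ℝ` as a manifold, with points `x = (z, t)`; in the real
coordinates `z_j = x_{2j-1} + i x_{2j}` and `t = x_{2n+1}`. -/
abbrev H (n : ℕ) : Type := (Fin n → ℂ) × ℝ

/-- The volume measure `2ⁿ dx_1 ⋯ dx_{2n+1}` of the Hermitian metric for which the `Z_j`, the
`conj Z_j` and `T = -∂/∂t` are orthonormal. -/
def vol (n : ℕ) : Measure (H n) := (2 : ℝ≥0∞) ^ n • volume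

/-- `∂/∂x_{2j-1}`, the derivative in the real part of `z_j`. -/
def dRe {n : ℕ} (j : Fin n) (f : H n → ℂ) (x : H n) : ℂ := fderiv ℝ f x (Pi.single j 1, 0)

/-- `∂/∂x_{2j}`, the derivative in the imaginary part of `z_j`. -/
def dIm {n : ℕ} (j : Fin n) (f : H n → ℂ) (x : H n) : ℂ :=
  fderiv ℝ f x (Pi.single j Complex.I, 0)

/-- `∂/∂x_{2n+1}`. -/
def dT {n : ℕ} (f : H n → ℂ) (x : H n) : ℂ := fderiv ℝ f x (0, 1)

/-- `∂/∂z̄_j = (∂/∂x_{2j-1} + i ∂/∂x_{2j}) / 2`. -/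
def dZbar {n : ℕ} (j : Fin n) (f : H n → ℂ) (x : H n) : ℂ :=
  (1 / 2 : ℂ) * (dRe j f x + Complex.I * dIm j f x)

/-- The vector field `conj Z_j = ∂/∂z̄_j + i λ_j z_j ∂/∂x_{2n+1}`, the complex conjugate of
`Z_j = ∂/∂z_j - i λ_j z̄_j ∂/∂x_{2n+1}`. The fields `conj Z_1, …, conj Z_n` span `T^{0,1}`. -/
def Zbar {n : ℕ} (lam : Fin n → ℝ) (j : Fin n) (f : H n → ℂ) (x : H n) : ℂ :=
  dZbar j f x + Complex.I * (lam j : ℂ) * x.1 j * dT f x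

/-- Strictly increasing multi-indices `J = (j_1 < ⋯ < j_q)` with entries in `{1, …, n}`,
as `q`-element sets. -/
abbrev MultiIndex (n q : ℕ) : Type := {J : Finset (Fin n) // J.card = q}

/-- The fibre of `Λ^q T^{*0,1}`: the vector `(a_J)_J` stands for `∑'_J a_J dz̄^J`. Since
`dz̄_1, …, dz̄_n` is dual to the orthonormal frame `conj Z_1, …, conj Z_n`, the forms `dz̄^J`
are an orthonormal basis of the fibre. -/
abbrev Fibre (n q : ℕ) : Type := EuclideanSpace ℂ (MultiIndex n q)

/-- The Hilbert space `L²_{(0,q)}(H_{n+1})` of square integrable `(0,q)`-forms. -/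
abbrev L2Form (n q : ℕ) : Type := Lp (Fibre n q) 2 (vol n)

/-- The coefficient `u_J` of `u = ∑'_J u_J dz̄^J`. -/
def coeff {n q : ℕ} (u : L2Form n q) (J : MultiIndex n q) : H n → ℂ := fun x => u x J

/-- Removing an entry `k` from a multi-index `K`. -/
def MultiIndex.erase {n q : ℕ} (K : MultiIndex n (q + 1)) (k : {k // k ∈ K.1}) :
    MultiIndex n q :=
  ⟨K.1.erase k.1, by rw [Finset.card_erase_of_mem k.2, K.2]; rfl⟩

/-- The `dz̄^K`-coefficient of `∑_k ∑'_J D_k(u_J) dz̄_k ∧ dz̄^J`. A pair `(k, J)` contributes to it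
only if `k ∉ J` and `K = J ∪ {k}`, and then `dz̄_k ∧ dz̄^J = (-1)^m dz̄^K`, where `m` is the number
of entries of `K` smaller than `k`. -/
def wedgeSum {n q : ℕ} {A B : Type*} [AddCommGroup B] (D : Fin n → A → B)
    (u : MultiIndex n q → A) (K : MultiIndex n (q + 1)) : B :=
  ∑ k : {k // k ∈ K.1}, (-1 : ℤ) ^ (K.1.filter (fun j => j < k.1)).card • D k.1 (u (K.erase k))

/-- The tangential Cauchy-Riemann operator on smooth forms (given by their coefficients):
`∂̄_b u = ∑_k ∑'_J (conj Z_k u_J) dz̄_k ∧ dz̄^J`. -/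
def dbarSmooth {n q : ℕ} (lam : Fin n → ℝ) (u : MultiIndex n q → H n → ℂ) :
    MultiIndex n (q + 1) → H n → ℂ :=
  wedgeSum (Zbar lam) u

/-- Test functions: smooth functions with compact support. -/
def IsTest {n : ℕ} (φ : H n → ℂ) : Prop := ContDiff ℝ ∞ φ ∧ HasCompactSupport φ

/-- The distribution `φ ↦ ∫ f φ dμ` defined by a locally integrable function `f`. -/
def toDist {n : ℕ} (f : H n → ℂ) (φ : H n → ℂ) : ℂ := ∫ x, f x * φ x ∂vol n

/-- The distributional derivative `conj Z_k f`, i.e. `φ ↦ -∫ f (conj Z_k φ) dμ`. (The transpose of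
`conj Z_k` is `-conj Z_k`, as `z_k` does not depend on `x_{2n+1}`.) -/
def distZbar {n : ℕ} (lam : Fin n → ℝ) (k : Fin n) (f : H n → ℂ) (φ : H n → ℂ) : ℂ :=
  -∫ x, f x * Zbar lam k φ x ∂vol n

/-- For `u ∈ L²_{(0,q)}` and `v ∈ L²_{(0,q+1)}`: `∂̄_b u = v` in the sense of distributions. -/
def IsWeakDbar {n q : ℕ} (lam : Fin n → ℝ) (u : L2Form n q) (v : L2Form n (q + 1)) : Prop :=
  ∀ (K : MultiIndex n (q + 1)) (φ : H n → ℂ), IsTest φ →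
    wedgeSum (distZbar lam) (coeff u) K φ = toDist (coeff v K) φ

lemma memLp_coeff {n q : ℕ} (u : L2Form n q) (J : MultiIndex n q) :
    MemLp (coeff u J) 2 (vol n) :=
  (EuclideanSpace.proj J : Fibre n q →L[ℂ] ℂ).comp_memLp' (Lp.memLp u)

lemma coeff_add {n q : ℕ} (u v : L2Form n q) (J : MultiIndex n q) :
    coeff (u + v) J =ᵐ[vol n] fun x => coeff u J x + coeff v J x := by
  filter_upwards [Lp.coeFn_add u v] with x hx
  simp only [coeff]
  rw [hx]
  simp

lemma coeff_smul {n q : ℕ} (c : ℂ) (u : L2Form n q) (J : MultiIndex n q) :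
    coeff (c • u) J =ᵐ[vol n] fun x => c * coeff u J x := by
  filter_upwards [Lp.coeFn_smul c u] with x hx
  simp only [coeff]
  rw [hx]
  simp

instance (n : ℕ) : IsFiniteMeasureOnCompacts (vol n) where
  lt_top_of_isCompact := fun K hK => by
    simp only [vol, Measure.smul_apply, smul_eq_mul]
    exact ENNReal.mul_lt_top (ENNReal.pow_lt_top (by simp)) hK.measure_lt_top

lemma memLp_test {n : ℕ} {ψ : H n → ℂ} (h : Continuous ψ) (hs : HasCompactSupport ψ) :
    MemLp ψ 2 (vol n) := h.memLp_of_hasCompactSupport hs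

lemma IsTest.zbar {n : ℕ} (lam : Fin n → ℝ) (k : Fin n) {φ : H n → ℂ} (h : IsTest φ) :
    Continuous (Zbar lam k φ) ∧ HasCompactSupport (Zbar lam k φ) := by
  have hc : Continuous (fderiv ℝ φ) := h.1.continuous_fderiv (by simp)
  refine ⟨?_, ?_⟩
  · unfold Zbar dZbar dRe dIm dT
    fun_prop
  · refine (h.2.fderiv (𝕜 := ℝ)).mono ?_
    intro x hx
    contrapose! hx
    simp only [Function.mem_support, not_not] at hx
    simp [Zbar, dZbar, dRe, dIm, dT, hx]

lemma integrable_pair {n : ℕ} {f ψ : H n → ℂ} (hf : MemLp f 2 (vol n)) (h : Continuous ψ)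
    (hs : HasCompactSupport ψ) : Integrable (fun x => f x * ψ x) (vol n) :=
  hf.integrable_mul (memLp_test h hs)

lemma integral_coeff_add {n q : ℕ} (u v : L2Form n q) (J : MultiIndex n q) {ψ : H n → ℂ}
    (h : Continuous ψ) (hs : HasCompactSupport ψ) :
    ∫ x, coeff (u + v) J x * ψ x ∂vol n =
      ∫ x, coeff u J x * ψ x ∂vol n + ∫ x, coeff v J x * ψ x ∂vol n := by
  rw [← integral_add (integrable_pair (memLp_coeff u J) h hs)
    (integrable_pair (memLp_coeff v J) h hs)]
  refine integral_congr_ae ?_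
  filter_upwards [coeff_add u v J] with x hx
  rw [hx, add_mul]

lemma integral_coeff_smul {n q : ℕ} (c : ℂ) (u : L2Form n q) (J : MultiIndex n q) (ψ : H n → ℂ) :
    ∫ x, coeff (c • u) J x * ψ x ∂vol n = c * ∫ x, coeff u J x * ψ x ∂vol n := by
  rw [← integral_const_mul]
  refine integral_congr_ae ?_
  filter_upwards [coeff_smul c u J] with x hx
  rw [hx, mul_assoc]

instance (n : ℕ) : (vol n).IsAddHaarMeasure :=
  haveI : (volume : Measure (H n)).IsAddHaarMeasure :=
    haveI h1 : (volume : Measure (Fin n → ℂ)).IsAddHaarMeasure :=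
      inferInstanceAs ((Measure.pi fun _ => (volume : Measure ℂ)).IsAddHaarMeasure)
    inferInstanceAs (((volume : Measure (Fin n → ℂ)).prod (volume : Measure ℝ)).IsAddHaarMeasure)
  Measure.IsAddHaarMeasure.smul _ (by simp) (ENNReal.pow_ne_top (by simp))

lemma toDist_Zbar {n : ℕ} (lam : Fin n → ℝ) (k : Fin n) {f φ : H n → ℂ} (hf : ContDiff ℝ ∞ f)
    (hφ : IsTest φ) : toDist (Zbar lam k f) φ = distZbar lam k f φ := by
  have hfc : Continuous f := hf.continuous
  have hφc : Continuous φ := hφ.1.continuous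
  have hf' : Continuous (fderiv ℝ f) := hf.continuous_fderiv (by simp)
  have hφ' : Continuous (fderiv ℝ φ) := hφ.1.continuous_fderiv (by simp)
  have hs' : ∀ v, HasCompactSupport (fun x => fderiv ℝ φ x v) := fun v =>
    hφ.2.fderiv_apply (𝕜 := ℝ) v
  -- integration by parts for a constant vector field
  have ibp : ∀ (v : H n) (g : H n → ℂ), ContDiff ℝ ∞ g →
      Integrable (fun x => g x * fderiv ℝ φ x v) (vol n) ∧
      Integrable (fun x => fderiv ℝ g x v * φ x) (vol n) ∧
      ∫ x, g x * fderiv ℝ φ x v ∂vol n = -∫ x, fderiv ℝ g x v * φ x ∂vol n := by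
    intro v g hg
    have hgc : Continuous g := hg.continuous
    have hg' : Continuous (fderiv ℝ g) := hg.continuous_fderiv (by simp)
    have i1 : Integrable (fun x => g x * fderiv ℝ φ x v) (vol n) :=
      Continuous.integrable_of_hasCompactSupport (by fun_prop) ((hs' v).mul_left)
    have i2 : Integrable (fun x => fderiv ℝ g x v * φ x) (vol n) :=
      Continuous.integrable_of_hasCompactSupport (by fun_prop) (hφ.2.mul_left)
    refine ⟨i1, i2, integral_mul_fderiv_eq_neg_fderiv_mul_of_integrable i2 i1 ?_ ?_ ?_⟩
    · exact Continuous.integrable_of_hasCompactSupport (by fun_prop) (hφ.2.mul_left)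
    · exact fun x _ => hg.differentiable (by simp) x
    · exact fun x _ => hφ.1.differentiable (by simp) x
  have hz : ContDiff ℝ ∞ (fun x : H n => x.1 k) := by fun_prop
  have hzf : ContDiff ℝ ∞ (fun x : H n => x.1 k * f x) := hz.mul hf
  have dz : ∀ x, fderiv ℝ (fun x : H n => x.1 k * f x) x (0, 1) = x.1 k * fderiv ℝ f x (0, 1) := by
    intro x
    have h1 : HasFDerivAt (fun x : H n => x.1 k)
        ((ContinuousLinearMap.proj (R := ℝ) (φ := fun _ : Fin n => ℂ) k).comp
          (ContinuousLinearMap.fst ℝ (Fin n → ℂ) ℝ)) x :=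
      ((ContinuousLinearMap.proj (R := ℝ) (φ := fun _ : Fin n => ℂ) k).comp
          (ContinuousLinearMap.fst ℝ (Fin n → ℂ) ℝ)).hasFDerivAt
    rw [show (fun x : H n => x.1 k * f x) = (fun x : H n => x.1 k) * f from rfl,
      (h1.mul (hf.differentiable (by simp) x).hasFDerivAt).fderiv]
    simp
  obtain ⟨a1, a2, a3⟩ := ibp (Pi.single k 1, 0) f hf
  obtain ⟨b1, b2, b3⟩ := ibp (Pi.single k Complex.I, 0) f hf
  obtain ⟨c1, c2, c3⟩ := ibp (0, 1) _ hzf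
  simp only [dz] at c2 c3
  have e1 : (fun x => Zbar lam k f x * φ x) = fun x =>
      (1 / 2 : ℂ) * (fderiv ℝ f x (Pi.single k 1, 0) * φ x)
      + (1 / 2 : ℂ) * Complex.I * (fderiv ℝ f x (Pi.single k Complex.I, 0) * φ x)
      + Complex.I * lam k * (x.1 k * fderiv ℝ f x (0, 1) * φ x) := by
    funext x; simp only [Zbar, dZbar, dRe, dIm, dT]; ring
  have e2 : (fun x => f x * Zbar lam k φ x) = fun x =>
      (1 / 2 : ℂ) * (f x * fderiv ℝ φ x (Pi.single k 1, 0))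
      + (1 / 2 : ℂ) * Complex.I * (f x * fderiv ℝ φ x (Pi.single k Complex.I, 0))
      + Complex.I * lam k * (x.1 k * f x * fderiv ℝ φ x (0, 1)) := by
    funext x; simp only [Zbar, dZbar, dRe, dIm, dT]; ring
  have split : ∀ {A B C : H n → ℂ} (a b c : ℂ), Integrable A (vol n) → Integrable B (vol n) →
      Integrable C (vol n) → ∫ x, a * A x + b * B x + c * C x ∂vol n =
        a * ∫ x, A x ∂vol n + b * ∫ x, B x ∂vol n + c * ∫ x, C x ∂vol n := by
    intro A B C a b c hA hB hC
    rw [integral_add (f := fun x => a * A x + b * B x) ((hA.const_mul a).add (hB.const_mul b))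
      (hC.const_mul c), integral_add (hA.const_mul a) (hB.const_mul b)]
    simp only [integral_const_mul]
  rw [toDist, distZbar, e1, e2, split _ _ _ a2 b2 c2, split _ _ _ a1 b1 c1]
  simp only [a3, b3, c3]
  ring

/-- On smooth forms the distributional `∂̄_b` is the classical one. -/
lemma toDist_dbarSmooth {n q : ℕ} (lam : Fin n → ℝ) {u : MultiIndex n q → H n → ℂ}
    (hu : ∀ J, ContDiff ℝ ∞ (u J)) (K : MultiIndex n (q + 1)) {φ : H n → ℂ} (hφ : IsTest φ) :
    toDist (dbarSmooth lam u K) φ = wedgeSum (distZbar lam) u K φ := by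
  have hi : ∀ (k : Fin n) (J : MultiIndex n q),
      Integrable (fun x => Zbar lam k (u J) x * φ x) (vol n) := by
    intro k J
    have h1 : Continuous (fderiv ℝ (u J)) := (hu J).continuous_fderiv (by simp)
    have h2 : Continuous φ := hφ.1.continuous
    refine Continuous.integrable_of_hasCompactSupport ?_ (hφ.2.mul_left)
    unfold Zbar dZbar dRe dIm dT
    fun_prop
  simp only [dbarSmooth, wedgeSum, Finset.sum_apply, Pi.smul_apply, ← toDist_Zbar lam _ (hu _) hφ]
  simp only [toDist, Finset.sum_apply, Pi.smul_apply, Finset.sum_mul, smul_mul_assoc]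
  refine (integral_finsetSum _ fun k _ => (hi _ _).smul ((-1 : ℤ) ^ _)).trans ?_
  refine Finset.sum_congr rfl fun k _ => ?_
  simp only [Pi.smul_apply, zsmul_eq_mul]
  exact integral_const_mul _ _

/-- The graph of the weak operator `∂̄_b`. -/
def dbarGraph {n : ℕ} (lam : Fin n → ℝ) (q : ℕ) :
    Submodule ℂ (L2Form n q × L2Form n (q + 1)) where
  carrier := {p | IsWeakDbar lam p.1 p.2}
  add_mem' := by
    intro a b ha hb K φ hφ
    have ha' := ha K φ hφ
    have hb' := hb K φ hφ
    have hz := fun k => hφ.zbar lam k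
    simp only [wedgeSum, distZbar, toDist, Finset.sum_apply, Pi.smul_apply, Prod.fst_add,
      Prod.snd_add] at ha' hb' ⊢
    rw [integral_coeff_add _ _ _ hφ.1.continuous hφ.2, ← ha', ← hb', ← Finset.sum_add_distrib]
    refine Finset.sum_congr rfl fun k _ => ?_
    rw [integral_coeff_add _ _ _ (hz k.1).1 (hz k.1).2, neg_add, smul_add]
  zero_mem' := by
    intro K φ hφ
    have h0 : ∀ {r : ℕ} (J : MultiIndex n r) (ψ : H n → ℂ),
        ∫ x, coeff (0 : L2Form n r) J x * ψ x ∂vol n = 0 := fun J ψ => by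
      simpa using integral_coeff_smul 0 0 J ψ
    simp [wedgeSum, distZbar, toDist, h0]
  smul_mem' := by
    intro c a ha K φ hφ
    have ha' := ha K φ hφ
    simp only [wedgeSum, distZbar, toDist, Finset.sum_apply, Pi.smul_apply, Prod.smul_fst,
      Prod.smul_snd] at ha' ⊢
    rw [integral_coeff_smul, ← ha', Finset.mul_sum]
    refine Finset.sum_congr rfl fun k _ => ?_
    rw [integral_coeff_smul, mul_smul_comm, mul_neg]

/-- The distributional `∂̄_b u` is unique, so that `dbarGraph` is the graph of an operator. -/
lemma dbarGraph_unique {n : ℕ} (lam : Fin n → ℝ) (q : ℕ)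
    (p : L2Form n q × L2Form n (q + 1)) (hp : p ∈ dbarGraph lam q) (h0 : p.1 = 0) : p.2 = 0 := by
  have key : ∀ K, ∀ᵐ x ∂vol n, coeff p.2 K x = 0 := by
    intro K
    refine ae_eq_zero_of_integral_contDiff_smul_eq_zero
      ((memLp_coeff p.2 K).locallyIntegrable (by norm_num)) ?_
    intro g hg hgs
    have ht : IsTest (fun x => (g x : ℂ)) :=
      ⟨Complex.ofRealCLM.contDiff.comp hg, hgs.comp_left (g := Complex.ofReal) (by simp)⟩
    have h := hp K _ ht
    have h1 : ∀ (J : MultiIndex n q) (ψ : H n → ℂ),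
        ∫ x, coeff (0 : L2Form n q) J x * ψ x ∂vol n = 0 := fun J ψ => by
      simpa using integral_coeff_smul 0 0 J ψ
    rw [h0] at h
    simp only [wedgeSum, distZbar, toDist, Finset.sum_apply, Pi.smul_apply, h1] at h
    simp only [neg_zero, smul_zero, Finset.sum_const_zero] at h
    rw [h]
    refine integral_congr_ae (Filter.Eventually.of_forall fun x => ?_)
    simp [mul_comm]
  rw [Lp.eq_zero_iff_ae_eq_zero]
  filter_upwards [ae_all_iff.2 key] with x hx
  ext K
  exact hx K

/-- The maximal (weak) extension
`∂̄_b : Dom ∂̄_b ⊆ L²_{(0,q)}(H_{n+1}) → L²_{(0,q+1)}(H_{n+1})`: a form `u` lies in the domain iff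
its distributional `∂̄_b u` is in `L²_{(0,q+1)}`. -/
def dbar {n : ℕ} (lam : Fin n → ℝ) (q : ℕ) : L2Form n q →ₗ.[ℂ] L2Form n (q + 1) :=
  (dbarGraph lam q).toLinearPMap

/-- The Hilbert space adjoint of `∂̄_b`. -/
def dbarStar {n : ℕ} (lam : Fin n → ℝ) (q : ℕ) : L2Form n (q + 1) →ₗ.[ℂ] L2Form n q :=
  (dbar lam q).adjoint

/-- Composition `g ∘ f` of partially defined operators, with domain
`{x ∈ Dom f | f x ∈ Dom g}`. -/
def pcomp {E F G : Type*} [AddCommGroup E] [Module ℂ E] [AddCommGroup F] [Module ℂ F]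
    [AddCommGroup G] [Module ℂ G] (g : F →ₗ.[ℂ] G) (f : E →ₗ.[ℂ] F) : E →ₗ.[ℂ] G :=
  g.comp (f.domRestrict ((g.domain.comap f.toFun).map f.domain.subtype)) (by
    rintro ⟨x, hx⟩
    obtain ⟨y, hy, hxy⟩ := hx.1
    have : f.domRestrict _ ⟨x, hx⟩ = f y := LinearPMap.domRestrict_apply hxy.symm
    rw [this]
    exact hy)

/-- The Gaffney extension of the Kohn Laplacian, `□_b = ∂̄_b ∂̄_b^* + ∂̄_b^* ∂̄_b`. The sum of
partially defined operators is defined on the intersection of their domains. On functions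
(`q = 0`) the first summand is absent, there being no forms of degree `-1`. -/
def kohnLaplacian {n : ℕ} (lam : Fin n → ℝ) : (q : ℕ) → (L2Form n q →ₗ.[ℂ] L2Form n q)
  | 0 => pcomp (dbarStar lam 0) (dbar lam 0)
  | q + 1 => pcomp (dbar lam q) (dbarStar lam q) + pcomp (dbarStar lam (q + 1)) (dbar lam (q + 1))

/-- `ℋ^q_b(H_{n+1}) = Ker □_b^{(q)}`, as a subspace of `L²_{(0,q)}(H_{n+1})`. -/
def harmonicSpace {n : ℕ} (lam : Fin n → ℝ) (q : ℕ) : Submodule ℂ (L2Form n q) :=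
  (LinearMap.ker (kohnLaplacian lam q).toFun).map (kohnLaplacian lam q).domain.subtype

end Heisenberg

end

noncomputable section

namespace Heisenberg

open ComplexConjugate

/-! Pairing `□_b u = 0` with `u` gives `∂̄_b u = 0` and `∂̄_b^* u = 0`. Since `conj Z_j` and `Z_k`
commute for `j ≠ k`, these two equations decouple (`weak_diagonal`): each coefficient `w = u_J`
weakly solves `∑_k A_k^* A_k w = 0`, where `A_k = Z_k` for `k ∈ J` and `A_k = conj Z_k` otherwise.
The sign `s_k = ∓1` records this choice.

The fields are left invariant for the Heisenberg group law, so convolving `w` on the left with a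
test function `ψ` gives a smooth, still square integrable solution `f = ψ * w`. This replaces any
regularity theory for `□_b`, and `w = 0` follows once every such `f` vanishes. Testing the equation
with `conj f χ_R²`, where `χ_R` is a dilated cutoff, yields `A_k f = 0` for all `k`
(`cField_eq_zero_of_weak`).

The commutator of `A_k` with its conjugate is `-2i s_k λ_k ∂/∂t`. If `λ_j = 0`, then also `A_j A_j^*
f = 0`, so the same energy argument gives `A_j^* f = 0`, and `f` is constant along a direction in
`ℂⁿ`. If `s_k λ_k > 0 > s_l λ_l`, a positive combination of `A_k A_k^* f` and `A_l A_l^* f` has no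
`∂/∂t` term and vanishes. Then `A_k^* f = 0`, and the commutator gives `∂f/∂t = 0`. A square
integrable function constant along lines is zero.

Opposite signs fail to occur for some `J`, all `λ_j` being nonzero, only when `J` is the set of
negative or of positive `λ_j`, that is, only for `q = n_-` or `q = n_+`. -/

variable {n : ℕ}

/-! ### Left invariant vector fields -/

/-- The real bilinear form `B(z, w) = 2 ∑ λ_k Im (conj z_k w_k)` of the group law
`(z, t) (w, s) = (z + w, t + s + B(z, w))`. -/
def twist (lam : Fin n → ℝ) : (Fin n → ℂ) →L[ℝ] (Fin n → ℂ) →L[ℝ] ℝ :=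
  ∑ k, (2 * lam k) • (ContinuousLinearMap.compL ℝ (Fin n → ℂ) ℂ ℝ Complex.imCLM).comp
    ((ContinuousLinearMap.mul ℝ ℂ).bilinearComp
      ((Complex.conjCLE : ℂ →L[ℝ] ℂ).comp (ContinuousLinearMap.proj k))
      (ContinuousLinearMap.proj k))

lemma twist_apply (lam : Fin n → ℝ) (z w : Fin n → ℂ) :
    twist lam z w = ∑ k, 2 * lam k * (conj (z k) * w k).im := by
  simp only [twist, FunLike.coe_sum, Finset.sum_apply]
  rfl

lemma twist_single (lam : Fin n → ℝ) (z : Fin n → ℂ) (k : Fin n) (a : ℂ) :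
    twist lam z (Pi.single k a) = 2 * lam k * (conj (z k) * a).im := by
  rw [twist_apply, Finset.sum_eq_single k]
  · simp
  · intro j _ hj
    simp [Pi.single_eq_of_ne hj]
  · simp

lemma twist_swap (lam : Fin n → ℝ) (z w : Fin n → ℂ) : twist lam z w = -twist lam w z := by
  simp only [twist_apply, ← Finset.sum_neg_distrib]
  refine Finset.sum_congr rfl fun k _ => ?_
  simp only [Complex.mul_im, Complex.conj_re, Complex.conj_im]
  ring

@[simp]
lemma twist_self (lam : Fin n → ℝ) (z : Fin n → ℂ) : twist lam z z = 0 := by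
  have := twist_swap lam z z
  linarith

/-- The left invariant vector field with value `(v, 0)` at the origin. -/
def leftVec (lam : Fin n → ℝ) (v : Fin n → ℂ) (x : H n) : H n := (v, twist lam x.1 v)

/-- The derivative along a left invariant vector field. -/
def lv (lam : Fin n → ℝ) (v : Fin n → ℂ) (f : H n → ℂ) (x : H n) : ℂ :=
  fderiv ℝ f x (leftVec lam v x)

lemma contDiff_leftVec (lam : Fin n → ℝ) (v : Fin n → ℂ) {m : WithTop ℕ∞} :
    ContDiff ℝ m (leftVec lam v) := by
  unfold leftVec
  fun_prop

lemma contDiff_lv (lam : Fin n → ℝ) (v : Fin n → ℂ) {f : H n → ℂ} (hf : ContDiff ℝ ∞ f) :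
    ContDiff ℝ ∞ (lv lam v f) :=
  (hf.fderiv_right (m := ∞) (by simp)).clm_apply (contDiff_leftVec lam v)

lemma support_fderiv_apply_subset {f : H n → ℂ} (V : H n → H n) :
    Function.support (fun x => fderiv ℝ f x (V x)) ⊆ tsupport f := by
  intro x hx
  by_contra h
  have : fderiv ℝ f x = 0 := by
    by_contra h'
    exact h (support_fderiv_subset ℝ (f := f) h')
  simp [this] at hx

lemma IsTest.lv (lam : Fin n → ℝ) (v : Fin n → ℂ) {f : H n → ℂ} (hf : IsTest f) :
    IsTest (lv lam v f) :=
  ⟨contDiff_lv lam v hf.1, hf.2.mono' (support_fderiv_apply_subset _)⟩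

lemma contDiff_dT {f : H n → ℂ} (hf : ContDiff ℝ ∞ f) : ContDiff ℝ ∞ (dT f) :=
  (hf.fderiv_right (m := ∞) (by simp)).clm_apply contDiff_const

lemma IsTest.dT {f : H n → ℂ} (hf : IsTest f) : IsTest (dT f) :=
  ⟨contDiff_dT hf.1, hf.2.mono' (support_fderiv_apply_subset _)⟩

lemma IsTest.mul_left {f g : H n → ℂ} (hg : IsTest g) (hf : ContDiff ℝ ∞ f) :
    IsTest (fun x => f x * g x) :=
  ⟨hf.mul hg.1, hg.2.mul_left⟩

lemma IsTest.add {f g : H n → ℂ} (hf : IsTest f) (hg : IsTest g) :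
    IsTest (fun x => f x + g x) :=
  ⟨hf.1.add hg.1, hf.2.add hg.2⟩

lemma IsTest.integrable {f : H n → ℂ} (hf : IsTest f) : Integrable f (vol n) :=
  hf.1.continuous.integrable_of_hasCompactSupport hf.2

lemma lv_mul (lam : Fin n → ℝ) (v : Fin n → ℂ) {f g : H n → ℂ} (hf : ContDiff ℝ ∞ f)
    (hg : ContDiff ℝ ∞ g) (x : H n) :
    lv lam v (fun x => f x * g x) x = lv lam v f x * g x + f x * lv lam v g x := by
  have := ((hf.differentiable (by simp) x).hasFDerivAt.mul
    (hg.differentiable (by simp) x).hasFDerivAt).fderiv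
  simp only [lv]
  rw [show (fun x => f x * g x) = f * g from rfl, this]
  simp only [add_apply, smul_apply, smul_eq_mul]
  ring

lemma lv_add (lam : Fin n → ℝ) (v : Fin n → ℂ) {f g : H n → ℂ} (hf : ContDiff ℝ ∞ f)
    (hg : ContDiff ℝ ∞ g) (x : H n) :
    lv lam v (fun x => f x + g x) x = lv lam v f x + lv lam v g x := by
  simp only [lv]
  rw [fderiv_fun_add (hf.differentiable (by simp) x) (hg.differentiable (by simp) x)]
  rfl

lemma lv_const_mul (lam : Fin n → ℝ) (v : Fin n → ℂ) (c : ℂ) {f : H n → ℂ}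
    (hf : ContDiff ℝ ∞ f) (x : H n) :
    lv lam v (fun x => c * f x) x = c * lv lam v f x := by
  simp only [lv]
  rw [fderiv_const_mul (hf.differentiable (by simp) x)]
  rfl

lemma lv_conj (lam : Fin n → ℝ) (v : Fin n → ℂ) {f : H n → ℂ} (hf : ContDiff ℝ ∞ f) (x : H n) :
    lv lam v (fun x => conj (f x)) x = conj (lv lam v f x) := by
  have h := ((Complex.conjCLE : ℂ →L[ℝ] ℂ).hasFDerivAt.comp x
    (hf.differentiable (by simp) x).hasFDerivAt).fderiv
  simp only [lv]
  rw [show (fun x => conj (f x)) = (Complex.conjCLE : ℂ →L[ℝ] ℂ) ∘ f from rfl, h]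
  rfl

/-- Apart from the Hessian, the product rule differentiates the coefficient `twist lam x.1 w` of the
second field, which is linear in `x.1` and points in the central direction. -/
lemma lv_lv (lam : Fin n → ℝ) (v w : Fin n → ℂ) {f : H n → ℂ} (hf : ContDiff ℝ ∞ f) (x : H n) :
    lv lam v (lv lam w f) x = fderiv ℝ (fderiv ℝ f) x (leftVec lam v x) (leftVec lam w x) +
      twist lam v w * dT f x := by
  have h1 : HasFDerivAt (leftVec lam w)
      ((0 : H n →L[ℝ] (Fin n → ℂ)).prod
        (((twist lam).flip w).comp (ContinuousLinearMap.fst ℝ (Fin n → ℂ) ℝ))) x :=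
    (hasFDerivAt_const w x).prodMk
      (((twist lam).flip w).comp (ContinuousLinearMap.fst ℝ (Fin n → ℂ) ℝ)).hasFDerivAt
  have h2 : HasFDerivAt (fderiv ℝ f) (fderiv ℝ (fderiv ℝ f) x) x :=
    ((hf.fderiv_right (m := ∞) (by simp)).differentiable (by simp) x).hasFDerivAt
  have h3 := (h2.clm_apply h1).fderiv
  have h4 : lv lam v (lv lam w f) x =
    fderiv ℝ (fun y => fderiv ℝ f y (leftVec lam w y)) x (leftVec lam v x) := rfl
  rw [h4, h3]
  have h5 : ((0 : Fin n → ℂ), twist lam v w) = twist lam v w • ((0 : Fin n → ℂ), (1 : ℝ)) := by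
    simp
  simp only [add_apply, ContinuousLinearMap.comp_apply,
    ContinuousLinearMap.flip_apply, ContinuousLinearMap.prod_apply]
  rw [add_comm]
  congr 1
  change fderiv ℝ f x (0, twist lam v w) = _
  rw [h5, map_smul, dT, Complex.real_smul]

/-- The Hessian terms agree by symmetry, while the central terms are antisymmetric and therefore
double. -/
lemma lv_comm (lam : Fin n → ℝ) (v w : Fin n → ℂ) {f : H n → ℂ} (hf : ContDiff ℝ ∞ f) (x : H n) :
    lv lam v (lv lam w f) x = lv lam w (lv lam v f) x + 2 * twist lam v w * dT f x := by
  have h : IsSymmSndFDerivAt ℝ f x := hf.contDiffAt.isSymmSndFDerivAt (by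
    rw [minSmoothness_of_isRCLikeNormedField]
    exact WithTop.coe_le_coe.2 le_top)
  rw [lv_lv lam v w hf, lv_lv lam w v hf, h.eq, twist_swap lam w v]
  push_cast
  ring

/-! ### Integration of left invariant derivatives -/

lemma integral_fderiv_eq_zero {g : H n → ℂ} (hg : IsTest g) (v : H n) :
    ∫ x, fderiv ℝ g x v ∂vol n = 0 := by
  have hg' : Continuous (fderiv ℝ g) := hg.1.continuous_fderiv (by simp)
  have h := integral_mul_fderiv_eq_neg_fderiv_mul_of_integrable (μ := vol n)
    (f := fun _ : H n => (1 : ℂ)) (g := g) (v := v) (by simp) ?_ ?_ ?_ ?_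
  · simpa using h
  · simp only [one_mul]
    exact Continuous.integrable_of_hasCompactSupport (by fun_prop) (hg.2.fderiv_apply (𝕜 := ℝ) v)
  · simpa using hg.integrable
  · exact fun x _ => differentiableAt_const _
  · exact fun x _ => hg.1.differentiable (by simp) x

lemma integral_dT_eq_zero {g : H n → ℂ} (hg : IsTest g) : ∫ x, dT g x ∂vol n = 0 :=
  integral_fderiv_eq_zero hg _

/-- The field is divergence free: its central coefficient does not depend on `t` and can be moved
inside `∂/∂t`. -/
lemma integral_lv_eq_zero (lam : Fin n → ℝ) (v : Fin n → ℂ) {g : H n → ℂ} (hg : IsTest g) :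
    ∫ x, lv lam v g x ∂vol n = 0 := by
  have hb : ContDiff ℝ ∞ (fun x : H n => (twist lam x.1 v : ℂ)) :=
    Complex.ofRealCLM.contDiff.comp
      (((twist lam).flip v).comp (ContinuousLinearMap.fst ℝ (Fin n → ℂ) ℝ)).contDiff
  have hbg := hg.mul_left hb
  have hb' : ∀ x : H n, fderiv ℝ (fun x : H n => (twist lam x.1 v : ℂ)) x (0, 1) = 0 := by
    intro x
    have := (Complex.ofRealCLM.comp (((twist lam).flip v).comp
      (ContinuousLinearMap.fst ℝ (Fin n → ℂ) ℝ))).hasFDerivAt (x := x)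
    erw [this.fderiv]
    simp
  have h : ∀ x, lv lam v g x =
      fderiv ℝ g x (v, 0) + dT (fun x : H n => (twist lam x.1 v : ℂ) * g x) x := by
    intro x
    have h5 : leftVec lam v x = (v, 0) + twist lam x.1 v • ((0 : Fin n → ℂ), (1 : ℝ)) := by
      simp [leftVec]
    have h6 := ((hb.differentiable (by simp) x).hasFDerivAt.mul
      (hg.1.differentiable (by simp) x).hasFDerivAt).fderiv
    simp only [lv, dT]
    rw [show (fun x : H n => (twist lam x.1 v : ℂ) * g x) =
      (fun x : H n => (twist lam x.1 v : ℂ)) * g from rfl, h6, h5, map_add, map_smul]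
    simp only [add_apply, smul_apply, smul_eq_mul, hb',
      Complex.real_smul]
    ring
  have hg' : Continuous (fderiv ℝ g) := hg.1.continuous_fderiv (by simp)
  simp only [h]
  rw [integral_add, integral_fderiv_eq_zero hg, integral_dT_eq_zero hbg, add_zero]
  · exact Continuous.integrable_of_hasCompactSupport (by fun_prop) (hg.2.fderiv_apply (𝕜 := ℝ) _)
  · exact hbg.dT.integrable

/-! ### Group translations and dilations -/

/-- The group law of the Heisenberg group. -/
def gmul (lam : Fin n → ℝ) (x y : H n) : H n := (x.1 + y.1, x.2 + y.2 + twist lam x.1 y.1)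

lemma contDiff_gmul (lam : Fin n → ℝ) : ContDiff ℝ ∞ (fun p : H n × H n => gmul lam p.1 p.2) := by
  unfold gmul
  have : ContDiff ℝ ∞ (fun p : H n × H n => twist lam p.1.1 p.2.1) :=
    (twist lam).isBoundedBilinearMap.contDiff.comp
      (contDiff_fst.fst.prodMk contDiff_snd.fst)
  fun_prop

/-- The differential of left translation by `g` carries the field at `x` to the field at `g x`. -/
lemma lv_comp_gmul (lam : Fin n → ℝ) (v : Fin n → ℂ) {f : H n → ℂ} (hf : ContDiff ℝ ∞ f)
    (g x : H n) : lv lam v (fun y => f (gmul lam g y)) x = lv lam v f (gmul lam g x) := by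
  have h1 : HasFDerivAt (gmul lam g)
      ((ContinuousLinearMap.fst ℝ (Fin n → ℂ) ℝ).prod
        (ContinuousLinearMap.snd ℝ (Fin n → ℂ) ℝ +
          (twist lam g.1).comp (ContinuousLinearMap.fst ℝ (Fin n → ℂ) ℝ))) x := by
    refine HasFDerivAt.prodMk ?_ (HasFDerivAt.add ?_ ?_)
    · exact (ContinuousLinearMap.fst ℝ (Fin n → ℂ) ℝ).hasFDerivAt.const_add _
    · exact (ContinuousLinearMap.snd ℝ (Fin n → ℂ) ℝ).hasFDerivAt.const_add _
    · exact ((twist lam g.1).comp (ContinuousLinearMap.fst ℝ (Fin n → ℂ) ℝ)).hasFDerivAt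
  have h2 := ((hf.differentiable (by simp) (gmul lam g x)).hasFDerivAt.comp x h1).fderiv
  simp only [lv]
  rw [show (fun y => f (gmul lam g y)) = f ∘ gmul lam g from rfl, h2]
  simp [leftVec, gmul, add_comm]

/-- The dilation `(z, t) ↦ (r z, r² t)`. -/
def dil (n : ℕ) (r : ℝ) : H n →L[ℝ] H n :=
  (r • ContinuousLinearMap.fst ℝ (Fin n → ℂ) ℝ).prod
    (r ^ 2 • ContinuousLinearMap.snd ℝ (Fin n → ℂ) ℝ)

/-- The fields are homogeneous of degree one because `t` scales by `r²` and `twist` is linear in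
`z`. This is the source of the `1/R` decay of the cutoffs. -/
lemma lv_comp_dil (lam : Fin n → ℝ) (v : Fin n → ℂ) {f : H n → ℂ} (hf : ContDiff ℝ ∞ f)
    (r : ℝ) (x : H n) :
    lv lam v (fun y => f (dil n r y)) x = r * lv lam v f (dil n r x) := by
  have h2 := ((hf.differentiable (by simp) (dil n r x)).hasFDerivAt.comp x
    (dil n r).hasFDerivAt).fderiv
  have h3 : dil n r (leftVec lam v x) = r • leftVec lam v (dil n r x) := by
    simp [dil, leftVec, pow_two, mul_assoc]
  simp only [lv]
  rw [show (fun y => f (dil n r y)) = f ∘ dil n r from rfl, h2]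
  rw [ContinuousLinearMap.comp_apply, h3, map_smul, Complex.real_smul]

/-! ### The fields `Z_k`, `conj Z_k` and their commutators -/

/-- The complex field `(X_k + i s Y_k) / 2` for the left invariant fields `X_k`, `Y_k` extending
`∂/∂x_{2k-1}` and `∂/∂x_{2k}`: it is `conj Z_k` for `s = 1` and `Z_k` for `s = -1`. -/
def cField (lam : Fin n → ℝ) (s : ℝ) (k : Fin n) (f : H n → ℂ) (x : H n) : ℂ :=
  1 / 2 * (lv lam (Pi.single k 1) f x + s * Complex.I * lv lam (Pi.single k Complex.I) f x)

lemma lv_eq (lam : Fin n → ℝ) (v : Fin n → ℂ) (f : H n → ℂ) (x : H n) :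
    lv lam v f x = fderiv ℝ f x (v, 0) + twist lam x.1 v * dT f x := by
  have h5 : leftVec lam v x = (v, 0) + twist lam x.1 v • ((0 : Fin n → ℂ), (1 : ℝ)) := by
    simp [leftVec]
  rw [lv, h5, map_add, map_smul, Complex.real_smul, dT]

lemma Zbar_eq_cField (lam : Fin n → ℝ) (k : Fin n) (f : H n → ℂ) :
    Zbar lam k f = cField lam 1 k f := by
  funext x
  rw [cField, lv_eq, lv_eq, twist_single, twist_single, Zbar, dZbar, dRe, dIm]
  have h1 : (conj (x.1 k) * 1).im = -(x.1 k).im := by simp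
  have h2 : (conj (x.1 k) * Complex.I).im = (x.1 k).re := by simp
  rw [h1, h2]
  conv_lhs => rw [← Complex.re_add_im (x.1 k)]
  push_cast
  ring_nf
  simp only [Complex.I_sq]
  ring

lemma contDiff_cField (lam : Fin n → ℝ) (s : ℝ) (k : Fin n) {f : H n → ℂ}
    (hf : ContDiff ℝ ∞ f) : ContDiff ℝ ∞ (cField lam s k f) :=
  contDiff_const.mul ((contDiff_lv lam _ hf).add (contDiff_const.mul (contDiff_lv lam _ hf)))

lemma IsTest.cField (lam : Fin n → ℝ) (s : ℝ) (k : Fin n) {f : H n → ℂ} (hf : IsTest f) :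
    IsTest (cField lam s k f) :=
  IsTest.mul_left ((hf.lv lam _).add ((hf.lv lam _).mul_left contDiff_const)) contDiff_const

lemma cField_mul (lam : Fin n → ℝ) (s : ℝ) (k : Fin n) {f g : H n → ℂ} (hf : ContDiff ℝ ∞ f)
    (hg : ContDiff ℝ ∞ g) (x : H n) :
    cField lam s k (fun x => f x * g x) x = cField lam s k f x * g x + f x * cField lam s k g x := by
  simp only [cField, lv_mul lam _ hf hg]
  ring

lemma cField_conj (lam : Fin n → ℝ) (s : ℝ) (k : Fin n) {f : H n → ℂ} (hf : ContDiff ℝ ∞ f)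
    (x : H n) : cField lam s k (fun x => conj (f x)) x = conj (cField lam (-s) k f x) := by
  simp only [cField, lv_conj lam _ hf]
  simp [Complex.conj_ofNat]

/-- The transpose of `cField s` is `-cField s`, and its Hilbert space adjoint is `-cField (-s)`. All
weak equations below use the bilinear pairing without conjugation. -/
lemma integral_cField_mul (lam : Fin n → ℝ) (s : ℝ) (k : Fin n) {f φ : H n → ℂ}
    (hf : ContDiff ℝ ∞ f) (hφ : IsTest φ) :
    ∫ x, cField lam s k f x * φ x ∂vol n = -∫ x, f x * cField lam s k φ x ∂vol n := by
  have h0 : ∫ x, cField lam s k (fun x => f x * φ x) x ∂vol n = 0 := by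
    have ht := hφ.mul_left hf
    simp only [cField]
    rw [integral_const_mul, integral_add (ht.lv lam _).integrable
      (((ht.lv lam _).integrable).const_mul _), integral_const_mul, integral_lv_eq_zero lam _ ht,
      integral_lv_eq_zero lam _ ht]
    simp
  simp only [cField_mul lam s k hf hφ.1] at h0
  rw [integral_add (hφ.mul_left (contDiff_cField lam s k hf)).integrable
    ((hφ.cField lam s k).mul_left hf).integrable] at h0
  linear_combination h0

lemma lv_cField (lam : Fin n → ℝ) (s : ℝ) (k : Fin n) (v : Fin n → ℂ) {f : H n → ℂ}
    (hf : ContDiff ℝ ∞ f) (x : H n) :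
    lv lam v (cField lam s k f) x = 1 / 2 * (lv lam v (lv lam (Pi.single k 1) f) x +
      s * Complex.I * lv lam v (lv lam (Pi.single k Complex.I) f) x) := by
  have h1 := contDiff_lv lam (Pi.single k 1) hf
  have h2 := contDiff_lv lam (Pi.single k Complex.I) hf
  have h3 : ContDiff ℝ ∞ (fun x => s * Complex.I * lv lam (Pi.single k Complex.I) f x) :=
    contDiff_const.mul h2
  rw [← lv_const_mul lam v _ h2, ← lv_add lam v h1 h3, ← lv_const_mul lam v _ (h1.add h3)]
  rfl

lemma cField_comm (lam : Fin n → ℝ) (s r : ℝ) {k l : Fin n} (hkl : k ≠ l) {f : H n → ℂ}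
    (hf : ContDiff ℝ ∞ f) (x : H n) :
    cField lam s k (cField lam r l f) x = cField lam r l (cField lam s k f) x := by
  have h : ∀ a b : ℂ, lv lam (Pi.single k a) (lv lam (Pi.single l b) f) x =
      lv lam (Pi.single l b) (lv lam (Pi.single k a) f) x := by
    intro a b
    rw [lv_comm lam _ _ hf, twist_single, Pi.single_eq_of_ne hkl.symm]
    simp
  simp only [cField.eq_1 lam s k (cField lam r l f), cField.eq_1 lam r l (cField lam s k f),
    lv_cField lam _ _ _ hf, h]
  ring

/-- From `[X_k, Y_k] = 4 λ_k ∂/∂t`. The sign of `s λ_k` decides the whole argument. -/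
lemma cField_comm_self (lam : Fin n → ℝ) (s : ℝ) (k : Fin n) {f : H n → ℂ}
    (hf : ContDiff ℝ ∞ f) (x : H n) :
    cField lam s k (cField lam (-s) k f) x =
      cField lam (-s) k (cField lam s k f) x - 2 * s * lam k * Complex.I * dT f x := by
  have h : lv lam (Pi.single k 1) (lv lam (Pi.single k Complex.I) f) x =
      lv lam (Pi.single k Complex.I) (lv lam (Pi.single k 1) f) x + 4 * lam k * dT f x := by
    rw [lv_comm lam _ _ hf, twist_single]
    simp only [Pi.single_eq_same, map_one, one_mul, Complex.I_im]
    push_cast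
    ring
  simp only [cField.eq_1 lam s k (cField lam (-s) k f), cField.eq_1 lam (-s) k (cField lam s k f),
    lv_cField lam _ _ _ hf, h]
  push_cast
  ring

lemma cField_comp_gmul (lam : Fin n → ℝ) (s : ℝ) (k : Fin n) {f : H n → ℂ}
    (hf : ContDiff ℝ ∞ f) (g : H n) :
    cField lam s k (fun y => f (gmul lam g y)) = fun x => cField lam s k f (gmul lam g x) := by
  funext x
  simp only [cField, lv_comp_gmul lam _ hf]

lemma cField_comp_dil (lam : Fin n → ℝ) (s : ℝ) (k : Fin n) {f : H n → ℂ}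
    (hf : ContDiff ℝ ∞ f) (r : ℝ) (x : H n) :
    cField lam s k (fun y => f (dil n r y)) x = r * cField lam s k f (dil n r x) := by
  simp only [cField, lv_comp_dil lam _ hf]
  ring

/-! ### Cutoffs and the energy argument -/

/-- Cut-off functions `χ_R` with `|(X_k + i s Y_k) χ_R| = O(1/R)`. -/
lemma exists_cutoff (lam : Fin n → ℝ) :
    ∃ χ : ℝ → H n → ℂ, (∀ R, 1 ≤ R → IsTest (χ R)) ∧ (∀ R x, conj (χ R x) = χ R x) ∧
      (∀ x, ∃ R₀, ∀ R, R₀ ≤ R → χ R x = 1) ∧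
      ∀ (s : ℝ) (k : Fin n), ∃ C, ∀ R, 1 ≤ R → ∀ x, ‖cField lam s k (χ R) x‖ ≤ C / R := by
  let b : ContDiffBump (0 : H n) := ⟨1, 2, by norm_num, by norm_num⟩
  let Θ : H n → ℂ := fun x => (b x : ℂ)
  have hΘ : IsTest Θ := ⟨Complex.ofRealCLM.contDiff.comp b.contDiff,
    b.hasCompactSupport.comp_left (g := Complex.ofReal) (by simp)⟩
  -- One fixed bump, equal to `1` on the unit ball, is spread out by the dilation of factor `R⁻¹`.
  refine ⟨fun R x => Θ (dil n R⁻¹ x), ?_, ?_, ?_, ?_⟩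
  · intro R hR
    have hR0 : R ≠ 0 := by positivity
    refine ⟨hΘ.1.comp (dil n R⁻¹).contDiff, ?_⟩
    let e : H n ≃ₜ H n :=
      { toFun := dil n R⁻¹
        invFun := dil n R
        left_inv := fun x => by simp [dil, smul_smul, hR0]
        right_inv := fun x => by simp [dil, smul_smul, hR0]
        continuous_toFun := (dil n R⁻¹).continuous
        continuous_invFun := (dil n R).continuous }
    exact hΘ.2.comp_homeomorph e
  · intro R x
    exact Complex.conj_ofReal _
  · intro x
    have hx : Filter.Tendsto (fun R : ℝ => dil n R⁻¹ x) Filter.atTop (nhds 0) := by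
      have h1 : Filter.Tendsto (fun R : ℝ => R⁻¹) Filter.atTop (nhds 0) := tendsto_inv_atTop_zero
      have h2 := (h1.smul_const x.1).prodMk_nhds ((h1.pow 2).smul_const x.2)
      simpa [dil, ← Prod.mk_zero_zero] using h2
    have := hx.eventually (Metric.ball_mem_nhds (0 : H n) one_pos)
    obtain ⟨R₀, h⟩ := Filter.eventually_atTop.1 this
    refine ⟨R₀, fun R hR => ?_⟩
    have h1 : b (dil n R⁻¹ x) = 1 := b.one_of_mem_closedBall (Metric.ball_subset_closedBall (h R hR))
    simp [Θ, h1]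
  · intro s k
    have ht := hΘ.cField lam s k
    obtain ⟨C, hC⟩ := ht.1.continuous.bounded_above_of_compact_support ht.2
    refine ⟨C, fun R hR x => ?_⟩
    rw [cField_comp_dil lam s k hΘ.1, norm_mul, Complex.norm_real, norm_inv, Real.norm_of_nonneg
      (by positivity), div_eq_inv_mul]
    have := hC (dil n R⁻¹ x)
    gcongr

lemma IsTest.norm_sq_integrable {f : H n → ℂ} (hf : IsTest f) :
    Integrable (fun x => ‖f x‖ ^ 2) (vol n) :=
  (memLp_test hf.1.continuous hf.2).norm.integrable_sq

lemma memLp_norm_sq_integrable {f : H n → ℂ} (hf : MemLp f 2 (vol n)) :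
    Integrable (fun x => ‖f x‖ ^ 2) (vol n) :=
  hf.norm.integrable_sq

/-- The localized energy inequality for one field. -/
lemma energy_le (lam : Fin n → ℝ) (s : ℝ) (k : Fin n) {f χ : H n → ℂ} (hf : ContDiff ℝ ∞ f)
    (hχ : IsTest χ) (hreal : ∀ x, conj (χ x) = χ x) :
    1 / 2 * ∫ x, ‖χ x * cField lam s k f x‖ ^ 2 ∂vol n -
        2 * ∫ x, ‖f x * cField lam (-s) k χ x‖ ^ 2 ∂vol n ≤
      -(∫ x, f x * cField lam s k (cField lam (-s) k
        (fun x => conj (f x) * (χ x * χ x))) x ∂vol n).re := by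
  have hcf : ContDiff ℝ ∞ (fun x => conj (f x)) :=
    (Complex.conjCLE : ℂ →L[ℝ] ℂ).contDiff.comp hf
  have hχχ : IsTest (fun x => χ x * χ x) := hχ.mul_left hχ.1
  have hφ := hχχ.mul_left hcf
  have ibp := integral_cField_mul lam s k hf (hφ.cField lam (-s) k)
  have hA := contDiff_cField lam s k hf
  have i1 := (hχ.mul_left hA).norm_sq_integrable
  have i2 := ((hχ.cField lam (-s) k).mul_left hf).norm_sq_integrable
  have i3 := ((hφ.cField lam (-s) k).mul_left hA).integrable
  have hre : -(∫ x, f x * cField lam s k (cField lam (-s) k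
        (fun x => conj (f x) * (χ x * χ x))) x ∂vol n).re =
      ∫ x, (cField lam s k f x * cField lam (-s) k
        (fun x => conj (f x) * (χ x * χ x)) x).re ∂vol n := by
    rw [← Complex.neg_re, ← ibp]
    exact (integral_re i3).symm
  rw [hre, ← integral_const_mul, ← integral_const_mul, ← integral_sub]
  · refine integral_mono_ae ?_ i3.re ?_
    · simp only [mul_comm (χ _)]
      exact (i1.const_mul _).sub (i2.const_mul _)
    · refine Filter.Eventually.of_forall fun x => ?_
      simp only
      rw [cField_mul lam (-s) k hcf hχχ.1, cField_mul lam (-s) k hχ.1 hχ.1,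
        cField_conj lam (-s) k hf, neg_neg]
      set a := χ x * cField lam s k f x with ha
      set b := f x * cField lam (-s) k χ x with hb
      -- After integration by parts the integrand is `|a|² + 2 Re (a b')`: the main term plus the
      -- error from differentiating `χ²`.
      set b' := conj (f x) * cField lam (-s) k χ x with hb'
      have hbb : ‖b‖ = ‖b'‖ := by simp [hb, hb']
      have e : cField lam s k f x * (conj (cField lam s k f x) * (χ x * χ x) +
          conj (f x) * (cField lam (-s) k χ x * χ x + χ x * cField lam (-s) k χ x)) =
          a * conj a + 2 * (a * b') := by
        simp only [ha, hb', map_mul, hreal]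
        ring
      have h1 : -(‖a‖ * ‖b'‖) ≤ (a * b').re := by
        rw [← norm_mul]
        exact (abs_le.1 (Complex.abs_re_le_norm _)).1
      have h2 : (a * conj a + 2 * (a * b')).re = ‖a‖ ^ 2 + 2 * (a * b').re := by
        rw [Complex.mul_conj, Complex.normSq_eq_norm_sq, Complex.add_re, Complex.ofReal_re]
        simp
      rw [e, h2, hbb]
      -- `2|a||b'| ≤ |a|²/2 + 2|b'|²` absorbs the cross term.
      nlinarith [sq_nonneg (‖a‖ - 2 * ‖b'‖)]
  · simp only [mul_comm (χ _)]
    exact i1.const_mul _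
  · exact i2.const_mul _

/-- A smooth square integrable weak solution of `∑ c_i A_i^* A_i f = 0` with `c_i > 0` is
annihilated by every `A_i`. -/
lemma cField_eq_zero_of_weak (lam : Fin n → ℝ) {ι : Type*} (I : Finset ι) (c s : ι → ℝ)
    (k : ι → Fin n) (hc : ∀ i ∈ I, 0 < c i) {f : H n → ℂ} (hf : ContDiff ℝ ∞ f)
    (hf2 : MemLp f 2 (vol n))
    (hweak : ∀ φ, IsTest φ → ∑ i ∈ I, (c i : ℂ) *
      ∫ x, f x * cField lam (s i) (k i) (cField lam (-s i) (k i) φ) x ∂vol n = 0) :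
    ∀ i ∈ I, cField lam (s i) (k i) f = 0 := by
  obtain ⟨χ, hχ, hreal, hone, hbound⟩ := exists_cutoff lam
  choose C hC using fun i => hbound (-s i) (k i)
  have hcf : ContDiff ℝ ∞ (fun x => conj (f x)) :=
    (Complex.conjCLE : ℂ →L[ℝ] ℂ).contDiff.comp hf
  set N := ∫ x, ‖f x‖ ^ 2 ∂vol n with hN
  set K := ∑ i ∈ I, c i * (4 * C i ^ 2 * N) with hK
  set E : ι → ℝ → ℝ := fun i R => ∫ x, ‖χ R x * cField lam (s i) (k i) f x‖ ^ 2 ∂vol n with hE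
  have main : ∀ R, 1 ≤ R → ∑ i ∈ I, c i * E i R ≤ K / R ^ 2 := by
    intro R hR
    -- The test function is `conj f χ_R²`, admissible because `f` is smooth.
    have h0 := congrArg Complex.re (hweak _ ((((hχ R hR).mul_left (hχ R hR).1)).mul_left hcf))
    rw [Complex.re_sum] at h0
    simp only [Complex.re_ofReal_mul, Complex.zero_re] at h0
    have h1 : ∀ i ∈ I, c i * (1 / 2 * E i R - 2 * (C i ^ 2 / R ^ 2 * N)) ≤
        -(c i * (∫ x, f x * cField lam (s i) (k i) (cField lam (-s i) (k i)
        (fun x => conj (f x) * (χ R x * χ R x))) x ∂vol n).re) := by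
      intro i hi
      rw [← mul_neg]
      refine mul_le_mul_of_nonneg_left (le_trans ?_
        (energy_le lam (s i) (k i) hf (hχ R hR) (hreal R))) (hc i hi).le
      have : ∫ x, ‖f x * cField lam (-s i) (k i) (χ R) x‖ ^ 2 ∂vol n ≤ C i ^ 2 / R ^ 2 * N := by
        rw [hN, ← integral_const_mul]
        refine integral_mono ((((hχ R hR).cField lam (-s i) (k i)).mul_left hf).norm_sq_integrable)
          ((memLp_norm_sq_integrable hf2).const_mul _) fun x => ?_
        simp only
        rw [norm_mul, mul_pow, mul_comm, ← div_pow]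
        have := hC i R hR x
        gcongr
      linarith
    have h2 := Finset.sum_le_sum h1
    rw [Finset.sum_neg_distrib, h0, neg_zero] at h2
    have h3 : ∑ i ∈ I, c i * (1 / 2 * E i R - 2 * (C i ^ 2 / R ^ 2 * N)) =
        1 / 2 * (∑ i ∈ I, c i * E i R - K / R ^ 2) := by
      rw [hK, Finset.sum_div, ← Finset.sum_sub_distrib, Finset.mul_sum]
      refine Finset.sum_congr rfl fun i _ => ?_
      ring
    rw [h3] at h2
    linarith
  intro i hi
  have hEnn : ∀ i R, 0 ≤ E i R := fun i R => integral_nonneg fun x => by positivity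
  have hEi : ∀ R, 1 ≤ R → E i R ≤ K / c i / R ^ 2 := by
    intro R hR
    have h1 : c i * E i R ≤ ∑ i ∈ I, c i * E i R :=
      Finset.single_le_sum (f := fun i => c i * E i R)
        (fun j hj => mul_nonneg (hc j hj).le (hEnn j R)) hi
    have := h1.trans (main R hR)
    rw [div_right_comm, le_div_iff₀ (hc i hi)]
    linarith
  have hm : ∀ m : ℕ, (1 : ℝ) ≤ m + 1 := fun m => by
    have : (0 : ℝ) ≤ m := m.cast_nonneg
    linarith
  have hlim : Filter.Tendsto (fun m : ℕ => E i (m + 1)) Filter.atTop (nhds 0) := by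
    have h1 : Filter.Tendsto (fun m : ℕ => K / c i / ((m : ℝ) + 1) ^ 2) Filter.atTop (nhds 0) := by
      refine Filter.Tendsto.const_div_atTop ?_ _
      exact (Filter.tendsto_pow_atTop two_ne_zero).comp
        (Filter.tendsto_atTop_add_const_right _ _ tendsto_natCast_atTop_atTop)
    exact squeeze_zero (fun m => hEnn i _)
      (fun m => hEi _ (hm m)) h1
  have hA := contDiff_cField lam (s i) (k i) hf
  -- The localized energies tend to `0` and `χ_R → 1` pointwise, so Fatou's lemma bounds the full
  -- energy by zero without assuming it finite.
  have hfatou := lintegral_liminf_le (μ := vol n) (u := Filter.atTop)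
    (f := fun (m : ℕ) x => ENNReal.ofReal (‖χ (m + 1) x * cField lam (s i) (k i) f x‖ ^ 2))
    (fun m => by
      have h1 := (hχ (m + 1) (hm m)).1.continuous
      exact (ENNReal.continuous_ofReal.comp ((h1.mul hA.continuous).norm.pow 2)).measurable)
  have hl : ∀ x, Filter.liminf (fun m : ℕ => ENNReal.ofReal
      (‖χ (m + 1) x * cField lam (s i) (k i) f x‖ ^ 2)) Filter.atTop =
      ENNReal.ofReal (‖cField lam (s i) (k i) f x‖ ^ 2) := by
    intro x
    obtain ⟨R₀, hR₀⟩ := hone x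
    refine Filter.Tendsto.liminf_eq (tendsto_const_nhds.congr' ?_)
    filter_upwards [Filter.eventually_ge_atTop ⌈R₀⌉₊] with m hm
    have : R₀ ≤ (m : ℝ) + 1 := by
      have := (Nat.le_ceil R₀).trans (Nat.cast_le.2 hm : ((⌈R₀⌉₊ : ℕ) : ℝ) ≤ m)
      linarith
    rw [hR₀ _ this, one_mul]
  have hr : ∀ m : ℕ, ∫⁻ x, ENNReal.ofReal
      (‖χ (m + 1) x * cField lam (s i) (k i) f x‖ ^ 2) ∂vol n = ENNReal.ofReal (E i (m + 1)) := by
    intro m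
    have h1 := hχ (m + 1) (hm m)
    refine (ofReal_integral_eq_lintegral_ofReal ?_
      (Filter.Eventually.of_forall fun x => by positivity)).symm
    simp only [mul_comm (χ _ _)]
    exact (h1.mul_left hA).norm_sq_integrable
  simp only [hl, hr] at hfatou
  rw [(ENNReal.tendsto_ofReal hlim).liminf_eq, ENNReal.ofReal_zero] at hfatou
  have hz := (lintegral_eq_zero_iff 
    (ENNReal.continuous_ofReal.comp (hA.continuous.norm.pow 2)).measurable).1 (le_antisymm hfatou bot_le)
  have hz' : cField lam (s i) (k i) f =ᵐ[vol n] 0 := by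
    filter_upwards [hz] with x hx
    simpa using hx
  exact (hA.continuous.ae_eq_iff_eq (vol n) continuous_zero).1 hz'

/-! ### Vanishing of smooth square integrable solutions -/

/-- If `f x₀ ≠ 0`, the set where `|f|²` exceeds half its value at `x₀` has finite measure. It
contains a ball, hence infinitely many disjoint translates of that ball along `v`, which is a
contradiction. -/
lemma eq_zero_of_fderiv_eq_zero {f : H n → ℂ} (hf : ContDiff ℝ ∞ f) (hf2 : MemLp f 2 (vol n))
    {v : H n} (hv : v ≠ 0) (h : ∀ x, fderiv ℝ f x v = 0) : f = 0 := by
  have hinv : ∀ (x : H n) (r : ℝ), f (x + r • v) = f x := by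
    intro x r
    have hd : ∀ r : ℝ, HasDerivAt (fun r : ℝ => f (x + r • v)) 0 r := by
      intro r
      have h1 : HasDerivAt (fun r : ℝ => x + r • v) v r := by
        simpa using ((hasDerivAt_id r).smul_const v).const_add x
      have h2 := (hf.differentiable (by simp) (x + r • v)).hasFDerivAt.comp_hasDerivAt r h1
      rwa [h] at h2
    have := is_const_of_deriv_eq_zero (fun r => (hd r).differentiableAt)
      (fun r => (hd r).deriv) r 0
    simpa using this
  by_contra hne
  obtain ⟨x₀, hx₀⟩ : ∃ x, f x ≠ 0 := by
    by_contra! h0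
    exact hne (funext h0)
  set g : H n → ℝ := fun x => ‖f x‖ ^ 2 with hg
  have hgi : Integrable g (vol n) := memLp_norm_sq_integrable hf2
  have hgc : Continuous g := hf.continuous.norm.pow 2
  have hpos : 0 < g x₀ := by positivity
  set S := {x | g x₀ / 2 < g x} with hS
  have hSo : IsOpen S := isOpen_lt continuous_const hgc
  have hSf : vol n S < ⊤ := hgi.measure_gt_lt_top (by positivity)
  obtain ⟨r, hr, hball⟩ := Metric.isOpen_iff.1 hSo x₀ (by simp only [hS, Set.mem_ofPred_eq]; linarith)
  have hv' : 0 < ‖v‖ := norm_pos_iff.2 hv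
  -- This spacing puts neighbouring centres exactly `2r` apart, so the open balls are disjoint.
  set d : ℝ := 2 * r / ‖v‖ with hd
  set A : ℕ → Set (H n) := fun m => Metric.ball (x₀ + (m * d) • v) r with hA
  have hdisj : Pairwise (Function.onFun Disjoint A) := by
    intro a b hab
    refine Metric.ball_disjoint_ball ?_
    rw [dist_add_left, dist_eq_norm, ← sub_smul, norm_smul, ← sub_mul, norm_mul]
    have h1 : ‖d‖ * ‖v‖ = 2 * r := by
      rw [Real.norm_of_nonneg (by positivity), hd]
      field_simp
    have h2 : (1 : ℝ) ≤ ‖(a : ℝ) - b‖ := by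
      have : (1 : ℤ) ≤ |(a : ℤ) - b| := Int.one_le_abs (by omega)
      rw [Real.norm_eq_abs]
      exact_mod_cast this
    rw [mul_assoc, h1]
    nlinarith
  have hsub : ⋃ m, A m ⊆ S := by
    refine Set.iUnion_subset fun m x hx => ?_
    have h1 : x + (-(m * d)) • v ∈ Metric.ball x₀ r := by
      rw [Metric.mem_ball, dist_eq_norm] at hx ⊢
      convert hx using 2
      module
    have h2 := hball h1
    simp only [hS, Set.mem_ofPred_eq, hg, hinv] at h2 ⊢
    exact h2
  have hmeas : ∀ m, vol n (A m) = vol n (Metric.ball x₀ r) := by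
    intro m
    rw [hA]
    simp only
    rw [Measure.addHaar_ball_center, Measure.addHaar_ball_center (vol n) x₀]
  have := (measure_mono hsub).trans_lt hSf
  rw [measure_iUnion hdisj (fun m => Metric.isOpen_ball.measurableSet)] at this
  simp only [hmeas] at this
  rw [ENNReal.tsum_const_eq_top_of_ne_zero (Metric.measure_ball_pos (vol n) x₀ hr).ne'] at this
  exact lt_irrefl _ this

/-- When `A f = 0`, exchanging the order of `A` and its conjugate leaves only the commutator. This
evaluates `A A^* f` as a multiple of `∂f/∂t`. -/
lemma integral_mul_comm_cField (lam : Fin n → ℝ) (s : ℝ) (k : Fin n) {f φ : H n → ℂ}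
    (hf : ContDiff ℝ ∞ f) (h : cField lam s k f = 0) (hφ : IsTest φ) :
    ∫ x, f x * cField lam (-s) k (cField lam s k φ) x ∂vol n =
      2 * (s * lam k : ℝ) * Complex.I * ∫ x, f x * dT φ x ∂vol n := by
  have h1 : ∫ x, f x * cField lam s k (cField lam (-s) k φ) x ∂vol n = 0 := by
    have := integral_cField_mul lam s k hf (hφ.cField lam (-s) k)
    rw [h] at this
    simpa using this.symm
  have h2 : ∀ x, f x * cField lam (-s) k (cField lam s k φ) x =
      f x * cField lam s k (cField lam (-s) k φ) x +
        2 * (s * lam k : ℝ) * Complex.I * (f x * dT φ x) := by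
    intro x
    rw [cField_comm_self lam s k hφ.1]
    push_cast
    ring
  simp only [h2]
  rw [integral_add, h1, integral_const_mul, zero_add]
  · exact (((hφ.cField lam (-s) k).cField lam s k).mul_left hf).integrable
  · exact (hφ.dT.mul_left hf).integrable.const_mul _

lemma lv_single_one_eq (lam : Fin n → ℝ) (s : ℝ) (k : Fin n) (f : H n → ℂ) (x : H n) :
    lv lam (Pi.single k 1) f x = cField lam s k f x + cField lam (-s) k f x := by
  simp only [cField]
  push_cast
  ring

/-- A smooth square integrable function with `(X_j + i s Y_j) f = 0` vanishes if `λ_j = 0`. -/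
lemma eq_zero_of_lam_eq_zero (lam : Fin n → ℝ) (s : ℝ) (j : Fin n) (hj : lam j = 0)
    {f : H n → ℂ} (hf : ContDiff ℝ ∞ f) (hf2 : MemLp f 2 (vol n))
    (h : cField lam s j f = 0) : f = 0 := by
  -- With `λ_j = 0` the commutator term is zero, so the energy argument applies to the conjugate
  -- field.
  have h1 : cField lam (-s) j f = 0 := by
    refine cField_eq_zero_of_weak lam {()} (fun _ => 1) (fun _ => -s) (fun _ => j)
      (by simp) hf hf2 (fun φ hφ => ?_) () (by simp)
    simp [integral_mul_comm_cField lam s j hf h hφ, hj]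
  refine eq_zero_of_fderiv_eq_zero hf hf2 (v := (Pi.single j 1, 0)) ?_ fun x => ?_
  · simp
  · have h2 := lv_single_one_eq lam s j f x
    rw [h, h1, lv_eq, twist_single, hj] at h2
    simpa using h2

/-- A smooth square integrable function annihilated by two of the fields `X_k + i s_k Y_k`
vanishes if the commutators of the fields with their conjugates have opposite signs. -/
lemma eq_zero_of_opposite_signs (lam : Fin n → ℝ) (s : Fin n → ℝ) {k l : Fin n}
    (hk : 0 < s k * lam k) (hl : s l * lam l < 0) {f : H n → ℂ} (hf : ContDiff ℝ ∞ f)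
    (hf2 : MemLp f 2 (vol n)) (h : ∀ i, cField lam (s i) i f = 0) : f = 0 := by
  have hkl : k ≠ l := by
    rintro rfl
    exact lt_asymm hk hl
  have h1 : cField lam (-s k) k f = 0 := by
    -- The weights normalize the two commutators to `±∂/∂t` of opposite sign, so they cancel.
    refine cField_eq_zero_of_weak lam {k, l} (fun i => |s i * lam i|⁻¹) (fun i => -s i) (fun i => i)
      ?_ hf hf2 (fun φ hφ => ?_) k (by simp)
    · intro i hi
      have : s i * lam i ≠ 0 := by
        rcases Finset.mem_insert.1 hi with rfl | hi
        · exact hk.ne'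
        · rw [Finset.mem_singleton.1 hi]
          exact hl.ne
      positivity
    · have e : ((|s k * lam k|⁻¹ : ℝ) : ℂ) * (s k * lam k : ℝ) +
          ((|s l * lam l|⁻¹ : ℝ) : ℂ) * (s l * lam l : ℝ) = 0 := by
        rw [← Complex.ofReal_mul, ← Complex.ofReal_mul, ← Complex.ofReal_add, abs_of_pos hk,
          abs_of_neg hl, inv_mul_cancel₀ hk.ne', inv_neg, neg_mul, inv_mul_cancel₀ hl.ne]
        simp
      rw [Finset.sum_pair hkl]
      simp only [neg_neg]
      rw [integral_mul_comm_cField lam _ k hf (h k) hφ, integral_mul_comm_cField lam _ l hf (h l) hφ]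
      linear_combination (2 * Complex.I * ∫ x, f x * dT φ x ∂vol n) * e
  refine eq_zero_of_fderiv_eq_zero hf hf2 (v := (0, 1)) (by simp) fun x => ?_
  have h2 := cField_comm_self lam (s k) k hf x
  have h3 : ∀ s, cField lam s k (0 : H n → ℂ) x = 0 := by
    intro s
    simp [cField, lv]
  rw [h k, h1, h3, h3, zero_sub, eq_comm, neg_eq_zero] at h2
  have h4 : (2 * s k * lam k * Complex.I : ℂ) ≠ 0 := by
    rw [mul_assoc (2 : ℂ), ← Complex.ofReal_mul]
    simp [hk.ne', -Complex.ofReal_mul]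
  exact (mul_eq_zero.1 h2).resolve_left h4

/-! ### Group convolution and reduction to smooth functions -/

lemma gmul_gmul_neg (lam : Fin n → ℝ) (g y : H n) : gmul lam (gmul lam g y) (-y) = g := by
  ext : 1
  · simp [gmul]
  · simp only [gmul, Prod.snd_neg, Prod.fst_neg, map_add, map_neg, add_apply, twist_self]
    ring

lemma gmul_neg_gmul (lam : Fin n → ℝ) (x y : H n) : gmul lam (gmul lam x (-y)) y = x := by
  simpa using gmul_gmul_neg lam x (-y)

lemma neg_gmul_gmul (lam : Fin n → ℝ) (g y : H n) : gmul lam (-g) (gmul lam g y) = y := by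
  ext : 1
  · simp [gmul]
  · simp only [gmul, Prod.snd_neg, Prod.fst_neg, map_add, map_neg, neg_apply, twist_self]
    ring

lemma neg_gmul_neg_gmul (lam : Fin n → ℝ) (x y : H n) :
    gmul lam (-(gmul lam x (-y))) x = y := by
  conv_lhs => rw [← gmul_neg_gmul lam x y]
  rw [gmul_gmul_neg, neg_gmul_gmul]

lemma continuous_gmul (lam : Fin n → ℝ) : Continuous (fun p : H n × H n => gmul lam p.1 p.2) :=
  (contDiff_gmul lam).continuous

/-- Left and right translations both have this form, so the volume is bi-invariant. -/
lemma measurePreserving_shear (a : Fin n → ℂ) (b : (Fin n → ℂ) → ℝ) (hb : Continuous b) :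
    MeasurePreserving (fun x : H n => (x.1 + a, x.2 + b x.1)) (vol n) (vol n) := by
  have h : MeasurePreserving (fun x : H n => (x.1 + a, x.2 + b x.1))
      ((volume : Measure (Fin n → ℂ)).prod (volume : Measure ℝ))
      ((volume : Measure (Fin n → ℂ)).prod (volume : Measure ℝ)) := by
    refine MeasurePreserving.skew_product (f := fun z : Fin n → ℂ => z + a)
      (g := fun z t => t + b z) (measurePreserving_add_right volume a) ?_ ?_
    · exact (by fun_prop : Continuous fun p : (Fin n → ℂ) × ℝ => p.2 + b p.1).measurable
    · exact Filter.Eventually.of_forall fun z => (measurePreserving_add_right volume (b z)).map_eq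
  exact h.smul_measure ((2 : ℝ≥0∞) ^ n)

lemma measurePreserving_gmul_right (lam : Fin n → ℝ) (y : H n) :
    MeasurePreserving (fun x => gmul lam x y) (vol n) (vol n) := by
  convert measurePreserving_shear y.1 (fun z => y.2 + twist lam z y.1) (by fun_prop) using 2
  simp [gmul, add_assoc]

lemma measurePreserving_gmul_left (lam : Fin n → ℝ) (g : H n) :
    MeasurePreserving (fun x => gmul lam g x) (vol n) (vol n) := by
  convert measurePreserving_shear g.1 (fun z => g.2 + twist lam g.1 z) (by fun_prop) using 2
  simp [gmul, add_comm, add_left_comm, add_assoc]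

/-- The group convolution `ψ * w`, i.e. `x ↦ ∫ ψ(x y⁻¹) w(y) dy`. -/
def gconv (lam : Fin n → ℝ) (ψ w : H n → ℂ) (x : H n) : ℂ :=
  ∫ y, w y * ψ (gmul lam x (-y)) ∂vol n

lemma contDiff_gconv (lam : Fin n → ℝ) {ψ w : H n → ℂ} (hψ : IsTest ψ) (hw : MemLp w 2 (vol n)) :
    ContDiff ℝ ∞ (gconv lam ψ w) := by
  have hloc : LocallyIntegrable w (vol n) := hw.locallyIntegrable (by norm_num)
  rw [contDiff_iff_contDiffAt]
  intro x₀
  -- Group convolution becomes additive convolution with a kernel depending on a parameter `p`,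
  -- evaluated at `p = x`: for `s = x - y`, `G x s` is `ψ (x y⁻¹)`.
  set G : H n → H n → ℂ := fun p s => ψ (gmul lam p (-(p - s))) with hG
  have hF : Continuous (fun q : H n × H n => q.1 + gmul lam (-q.1) q.2) :=
    continuous_fst.add ((continuous_gmul lam).comp (continuous_fst.neg.prodMk continuous_snd))
  have key := contDiffOn_convolution_right_with_param_comp (𝕜 := ℝ) (n := ⊤) (μ := vol n)
    (ContinuousLinearMap.mul ℝ ℂ)
    (s := Metric.ball x₀ 1) (v := fun x => x) (f := w) (g := G)
    -- Solving `u = p (-(p - s))` for `s` gives `s = p + (-p) u`. The image is thus one compact set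
    -- containing the supports of `G p` for all `p` in the ball.
    (k := (fun q : H n × H n => q.1 + gmul lam (-q.1) q.2) ''
      (Metric.closedBall x₀ 1 ×ˢ tsupport ψ))
    contDiffOn_id Metric.isOpen_ball
    (((isCompact_closedBall x₀ 1).prod hψ.2).image hF) ?_ hloc ?_
  · have h2 := key.contDiffAt (Metric.isOpen_ball.mem_nhds (Metric.mem_ball_self one_pos))
    refine h2.congr_of_eventuallyEq (Filter.Eventually.of_forall fun x => ?_)
    simp [convolution, gconv, hG]
  · intro p s hp hs
    by_contra hne
    refine hs ⟨(p, gmul lam p (-(p - s))), ⟨Metric.ball_subset_closedBall hp,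
      subset_tsupport ψ hne⟩, ?_⟩
    simp only [neg_gmul_gmul]
    abel
  · refine ContDiff.contDiffOn ?_
    exact hψ.1.comp ((contDiff_gmul lam).comp
      (contDiff_fst.prodMk (contDiff_fst.sub contDiff_snd).neg))

/-- Only the values of `w` on a compact projection of the support matter, and there `w` is
integrable. This justifies Fubini below. -/
lemma integrable_prod_mul {w : H n → ℂ} (hw : MemLp w 2 (vol n)) {Ψ : H n × H n → ℂ}
    (hΨ : Continuous Ψ) (hs : HasCompactSupport Ψ) :
    Integrable (fun p : H n × H n => w p.2 * Ψ p) ((vol n).prod (vol n)) := by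
  have hloc : LocallyIntegrable w (vol n) := hw.locallyIntegrable (by norm_num)
  have hK1 : IsCompact (Prod.fst '' tsupport Ψ) := hs.isCompact.image continuous_fst
  have hK2 : IsCompact (Prod.snd '' tsupport Ψ) := hs.isCompact.image continuous_snd
  obtain ⟨C, hC⟩ := hΨ.bounded_above_of_compact_support hs
  have h1 : Integrable (Set.indicator (Prod.fst '' tsupport Ψ) (fun _ => (1 : ℂ))) (vol n) :=
    (integrable_indicator_iff hK1.measurableSet).2
      (integrableOn_const hK1.measure_lt_top.ne)
  have h2 : Integrable (Set.indicator (Prod.snd '' tsupport Ψ) w) (vol n) :=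
    (integrable_indicator_iff hK2.measurableSet).2 (hloc.integrableOn_isCompact hK2)
  have h3 := (h1.mul_prod h2).bdd_mul hΨ.aestronglyMeasurable
    (Filter.Eventually.of_forall hC)
  refine h3.congr (Filter.Eventually.of_forall fun p => ?_)
  simp only
  by_cases hp : p ∈ tsupport Ψ
  · rw [Set.indicator_of_mem (Set.mem_image_of_mem _ hp),
      Set.indicator_of_mem (Set.mem_image_of_mem _ hp)]
    ring
  · simp [image_eq_zero_of_notMem_tsupport hp]

/-- If `w` is orthogonal to all left translates of `Φ`, so is `ψ * w` to `Φ`. -/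
lemma integral_gconv_mul_eq_zero (lam : Fin n → ℝ) {ψ w Φ : H n → ℂ} (hψ : IsTest ψ)
    (hw : MemLp w 2 (vol n)) (hΦ : IsTest Φ)
    (h : ∀ g, ∫ y, w y * Φ (gmul lam g y) ∂vol n = 0) :
    ∫ x, gconv lam ψ w x * Φ x ∂vol n = 0 := by
  have hm := continuous_gmul lam
  have hψc := hψ.1.continuous
  have hΦc := hΦ.1.continuous
  have hc1 : Continuous (fun p : H n × H n => gmul lam p.1 (-p.2)) :=
    hm.comp (continuous_fst.prodMk continuous_snd.neg)
  have hc2 : Continuous (fun p : H n × H n => gmul lam (-p.1) p.2) :=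
    hm.comp (continuous_fst.neg.prodMk continuous_snd)
  have i1 := integrable_prod_mul hw
    (Ψ := fun p : H n × H n => ψ (gmul lam p.1 (-p.2)) * Φ p.1)
    ((hψc.comp hc1).mul (hΦc.comp continuous_fst)) (by
      refine HasCompactSupport.intro ((hψ.2.isCompact.prod hΦ.2.isCompact).image
        (continuous_snd.prodMk hc2)) fun p hp => ?_
      by_contra hne
      refine hp ⟨(gmul lam p.1 (-p.2), p.1), ⟨subset_tsupport ψ (left_ne_zero_of_mul hne),
        subset_tsupport Φ (right_ne_zero_of_mul hne)⟩, ?_⟩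
      simp [neg_gmul_neg_gmul])
  have i2 := integrable_prod_mul hw
    (Ψ := fun p : H n × H n => ψ p.1 * Φ (gmul lam p.1 p.2))
    ((hψc.comp continuous_fst).mul (hΦc.comp hm)) (by
      refine HasCompactSupport.intro ((hψ.2.isCompact.prod hΦ.2.isCompact).image
        (continuous_fst.prodMk hc2)) fun p hp => ?_
      by_contra hne
      refine hp ⟨(p.1, gmul lam p.1 p.2), ⟨subset_tsupport ψ (left_ne_zero_of_mul hne),
        subset_tsupport Φ (right_ne_zero_of_mul hne)⟩, ?_⟩
      simp [neg_gmul_gmul])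
  calc ∫ x, gconv lam ψ w x * Φ x ∂vol n
      = ∫ x, ∫ y, w y * (ψ (gmul lam x (-y)) * Φ x) ∂vol n ∂vol n := by
        refine integral_congr_ae (Filter.Eventually.of_forall fun x => ?_)
        simp only [gconv, ← mul_assoc]
        rw [integral_mul_const]
    _ = ∫ y, ∫ x, w y * (ψ (gmul lam x (-y)) * Φ x) ∂vol n ∂vol n := integral_integral_swap i1
    -- Substitution `x = g y`, by right invariance of the volume.
    _ = ∫ y, ∫ g, w y * (ψ g * Φ (gmul lam g y)) ∂vol n ∂vol n := by
        refine integral_congr_ae (Filter.Eventually.of_forall fun y => ?_)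
        simp only
        let e : H n ≃ₜ H n :=
          { toFun := fun g => gmul lam g y
            invFun := fun x => gmul lam x (-y)
            left_inv := fun g => gmul_gmul_neg lam g y
            right_inv := fun x => gmul_neg_gmul lam x y
            continuous_toFun := hm.comp (continuous_id.prodMk continuous_const)
            continuous_invFun := hm.comp (continuous_id.prodMk continuous_const) }
        have := (measurePreserving_gmul_right lam y).integral_comp e.measurableEmbedding
          (fun x => w y * (ψ (gmul lam x (-y)) * Φ x))
        rw [← this]
        simp [gmul_gmul_neg]
    _ = ∫ g, ∫ y, w y * (ψ g * Φ (gmul lam g y)) ∂vol n ∂vol n := (integral_integral_swap i2).symm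
    _ = 0 := by
        refine integral_eq_zero_of_ae (Filter.Eventually.of_forall fun g => ?_)
        simp only [mul_left_comm (w _), integral_const_mul, h, mul_zero, Pi.zero_apply]

/-- Cauchy–Schwarz for `a b^{1/2}` and `b^{1/2}`. -/
lemma lintegral_mul_sq_le {α : Type*} [MeasurableSpace α] {μ : Measure α} {a b : α → ℝ≥0∞}
    (ha : AEMeasurable a μ) (hb : AEMeasurable b μ) :
    (∫⁻ y, a y * b y ∂μ) ^ 2 ≤ (∫⁻ y, a y ^ 2 * b y ∂μ) * ∫⁻ y, b y ∂μ := by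
  have hh : ∀ c : ℝ≥0∞, (c ^ (1 / 2 : ℝ)) ^ (2 : ℝ) = c := fun c => by
    rw [← ENNReal.rpow_mul]
    norm_num
  have h := ENNReal.lintegral_mul_le_Lp_mul_Lq μ Real.HolderConjugate.two_two
    (ha.mul (hb.pow_const (1 / 2 : ℝ))) (hb.pow_const (1 / 2 : ℝ))
  have e1 : ∀ y, ((a * fun y => b y ^ (1 / 2 : ℝ)) * fun y => b y ^ (1 / 2 : ℝ)) y =
      a y * b y := by
    intro y
    simp only [Pi.mul_apply]
    rw [mul_assoc, ← ENNReal.rpow_add_of_nonneg _ _ (by norm_num) (by norm_num)]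
    norm_num
  have e2 : ∀ y, ((a * fun y => b y ^ (1 / 2 : ℝ)) y) ^ (2 : ℝ) = a y ^ 2 * b y := by
    intro y
    simp only [Pi.mul_apply]
    rw [ENNReal.mul_rpow_of_nonneg _ _ (by norm_num), hh]
    norm_num
  simp only [e2, e1, hh] at h
  rw [← ENNReal.mul_rpow_of_nonneg _ _ (by norm_num)] at h
  calc (∫⁻ y, a y * b y ∂μ) ^ 2 = (∫⁻ y, a y * b y ∂μ) ^ (2 : ℝ) := by norm_num
    _ ≤ (((∫⁻ y, a y ^ 2 * b y ∂μ) * ∫⁻ y, b y ∂μ) ^ (1 / 2 : ℝ)) ^ (2 : ℝ) :=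
        ENNReal.rpow_le_rpow h (by norm_num)
    _ = _ := hh _

/-- Young's inequality `L¹ * L² ⊆ L²`. The kernel `ψ (x y⁻¹)` has mass `N` in either variable, by
invariance under both translations and inversion. -/
lemma memLp_gconv (lam : Fin n → ℝ) {ψ w : H n → ℂ} (hψ : IsTest ψ) (hw : MemLp w 2 (vol n)) :
    MemLp (gconv lam ψ w) 2 (vol n) := by
  have hψc := hψ.1.continuous
  have hc1 : Continuous (fun p : H n × H n => gmul lam p.1 (-p.2)) :=
    (continuous_gmul lam).comp (continuous_fst.prodMk continuous_snd.neg)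
  refine ⟨(contDiff_gconv lam hψ hw).continuous.aestronglyMeasurable, ?_⟩
  rw [eLpNorm_lt_top_iff_lintegral_rpow_enorm_lt_top (by norm_num) (by norm_num)]
  have hw' := hw.2
  rw [eLpNorm_lt_top_iff_lintegral_rpow_enorm_lt_top (by norm_num) (by norm_num)] at hw'
  simp only [ENNReal.toReal_ofNat, ENNReal.rpow_ofNat] at hw' ⊢
  set N := ∫⁻ y, ‖ψ y‖ₑ ∂vol n with hN
  have hNfin : N < ⊤ := hψ.integrable.2
  have hx : ∀ x, ∫⁻ y, ‖ψ (gmul lam x (-y))‖ₑ ∂vol n = N := by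
    intro x
    exact ((measurePreserving_gmul_left lam x).comp
      (Measure.measurePreserving_neg (vol n))).lintegral_comp (f := fun y => ‖ψ y‖ₑ)
        hψc.enorm.measurable
  have hy : ∀ y, ∫⁻ x, ‖ψ (gmul lam x (-y))‖ₑ ∂vol n = N := by
    intro y
    exact (measurePreserving_gmul_right lam (-y)).lintegral_comp (f := fun y => ‖ψ y‖ₑ)
        hψc.enorm.measurable
  have hb : ∀ x, Measurable (fun y => ‖ψ (gmul lam x (-y))‖ₑ) := fun x =>
    (hψc.comp (hc1.comp (continuous_const.prodMk continuous_id))).enorm.measurable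
  calc ∫⁻ x, ‖gconv lam ψ w x‖ₑ ^ 2 ∂vol n
      ≤ ∫⁻ x, (∫⁻ y, ‖w y‖ₑ ^ 2 * ‖ψ (gmul lam x (-y))‖ₑ ∂vol n) * N ∂vol n := by
        refine lintegral_mono fun x => ?_
        rw [← hx x]
        refine le_trans ?_ (lintegral_mul_sq_le hw.1.enorm (hb x).aemeasurable)
        gcongr
        refine (enorm_integral_le_lintegral_enorm _).trans_eq ?_
        simp only [enorm_mul]
    _ = (∫⁻ x, ∫⁻ y, ‖w y‖ₑ ^ 2 * ‖ψ (gmul lam x (-y))‖ₑ ∂vol n ∂vol n) * N :=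
        lintegral_mul_const' _ _ hNfin.ne
    _ = (∫⁻ y, ∫⁻ x, ‖w y‖ₑ ^ 2 * ‖ψ (gmul lam x (-y))‖ₑ ∂vol n ∂vol n) * N := by
        rw [lintegral_lintegral_swap]
        exact (hw.1.comp_snd.enorm.pow_const 2).mul (hψc.comp hc1).enorm.measurable.aemeasurable
    _ = (∫⁻ y, ‖w y‖ₑ ^ 2 ∂vol n) * N * N := by
        congr 1
        rw [← lintegral_mul_const' _ _ hNfin.ne]
        refine lintegral_congr_ae (Filter.Eventually.of_forall fun y => ?_)
        simp only
        rw [lintegral_const_mul, hy]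
        exact (hψc.comp (hc1.comp (continuous_id.prodMk continuous_const))).enorm.measurable
    _ < ⊤ := ENNReal.mul_lt_top (ENNReal.mul_lt_top hw' hNfin) hNfin

/-- No approximate identity is needed: for `ψ = g ∘ neg`, the value of `ψ * w` at the identity is
already `∫ g w`. -/
lemma ae_eq_zero_of_gconv_eq_zero (lam : Fin n → ℝ) {w : H n → ℂ} (hw : MemLp w 2 (vol n))
    (h : ∀ ψ, IsTest ψ → gconv lam ψ w = 0) : ∀ᵐ x ∂vol n, w x = 0 := by
  refine ae_eq_zero_of_integral_contDiff_smul_eq_zero (hw.locallyIntegrable (by norm_num)) ?_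
  intro g hg hgs
  have ht : IsTest (fun x => ((g (-x) : ℝ) : ℂ)) :=
    ⟨Complex.ofRealCLM.contDiff.comp (hg.comp contDiff_neg),
      (hgs.comp_homeomorph (Homeomorph.neg (H n))).comp_left (g := Complex.ofReal) (by simp)⟩
  have h0 := congrFun (h _ ht) 0
  simp only [gconv, Pi.zero_apply] at h0
  rw [← h0]
  refine integral_congr_ae (Filter.Eventually.of_forall fun x => ?_)
  have : gmul lam 0 (-x) = -x := by simp [gmul, Prod.ext_iff]
  simp [this, mul_comm]

/-- A square integrable weak solution of `∑_k A_k^* A_k w = 0`, where `A_k` is one of the fields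
`Z_k`, `conj Z_k` for each `k`, vanishes if some `λ_j` is zero or two commutators `[A_k, A_k^*]`
have opposite signs. -/
theorem ae_eq_zero_of_weak (lam s : Fin n → ℝ) {w : H n → ℂ} (hw : MemLp w 2 (vol n))
    (hweak : ∀ φ, IsTest φ → ∑ k,
      ∫ x, w x * cField lam (s k) k (cField lam (-s k) k φ) x ∂vol n = 0)
    (hlam : (∃ j, lam j = 0) ∨ ∃ k l, 0 < s k * lam k ∧ s l * lam l < 0) :
    ∀ᵐ x ∂vol n, w x = 0 := by
  refine ae_eq_zero_of_gconv_eq_zero lam hw fun ψ hψ => ?_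
  have hf := contDiff_gconv lam hψ hw
  have hf2 := memLp_gconv lam hψ hw
  have h : ∀ k, cField lam (s k) k (gconv lam ψ w) = 0 := by
    intro k
    refine cField_eq_zero_of_weak lam Finset.univ (fun _ => 1) s (fun k => k) (by simp) hf hf2 ?_
      k (Finset.mem_univ k)
    intro φ hφ
    have ht := fun k => (hφ.cField lam (-s k) k).cField lam (s k) k
    have htest : IsTest (fun x => ∑ k, cField lam (s k) k (cField lam (-s k) k φ) x) := by
      refine ⟨ContDiff.sum fun k _ => (ht k).1, ?_⟩
      refine hφ.2.mono' fun x hx => ?_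
      by_contra hxφ
      refine hx (Finset.sum_eq_zero fun k _ => ?_)
      have hsub : ∀ (r : ℝ) (f : H n → ℂ), tsupport (cField lam r k f) ⊆ tsupport f := by
        intro r f
        refine closure_minimal (fun y hy => ?_) (isClosed_tsupport f)
        by_contra hyf
        have h0 : fderiv ℝ f y = 0 := by
          by_contra h'
          exact hyf (support_fderiv_subset ℝ (f := f) h')
        exact hy (by simp [cField, lv, h0])
      exact image_eq_zero_of_notMem_tsupport fun hmem => hxφ (hsub _ _ (hsub _ _ hmem))
    have := integral_gconv_mul_eq_zero lam hψ hw htest fun g => ?_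
    · simp only [Finset.mul_sum] at this
      rw [integral_finsetSum _ fun k _ => ((ht k).mul_left hf).integrable] at this
      simpa using this
    · have hφg : IsTest (fun y => φ (gmul lam g y)) := by
        let e : H n ≃ₜ H n :=
          { toFun := fun x => gmul lam g x
            invFun := fun x => gmul lam (-g) x
            left_inv := fun x => neg_gmul_gmul lam g x
            right_inv := fun x => by simpa using neg_gmul_gmul lam (-g) x
            continuous_toFun := (continuous_gmul lam).comp (continuous_const.prodMk continuous_id)
            continuous_invFun :=
              (continuous_gmul lam).comp (continuous_const.prodMk continuous_id) }
        exact ⟨hφ.1.comp ((contDiff_gmul lam).comp (contDiff_const.prodMk contDiff_id)),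
          hφ.2.comp_homeomorph e⟩
      -- Left invariance moves the translation past the fields, so the equation for translated test
      -- functions is the orthogonality required of `w`.
      have h1 := hweak _ hφg
      simp only [cField_comp_gmul lam _ _ hφ.1,
        cField_comp_gmul lam _ _ (hφ.cField lam _ _).1] at h1
      simp only [Finset.mul_sum]
      rw [integral_finsetSum, h1]
      intro k _
      have h2 := (hφg.cField lam (-s k) k).cField lam (s k) k
      simp only [cField_comp_gmul lam _ _ hφ.1,
        cField_comp_gmul lam _ _ (hφ.cField lam _ _).1] at h2
      exact integrable_pair hw h2.1.continuous h2.2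
  rcases hlam with ⟨j, hj⟩ | ⟨k, l, hk, hl⟩
  · exact eq_zero_of_lam_eq_zero lam (s j) j hj hf hf2 (h j)
  · exact eq_zero_of_opposite_signs lam s hk hl hf hf2 h

/-! ### Diagonalization of the Kohn Laplacian -/

/-- The sign of `dz̄_k ∧ dz̄^J` relative to `dz̄^K` for `K = J ∪ {k}`. -/
def wedgeSign (k : Fin n) (K : Finset (Fin n)) : ℂ := (-1) ^ (K.filter (fun j => j < k)).card

lemma wedgeSign_mul_self (k : Fin n) (K : Finset (Fin n)) : wedgeSign k K * wedgeSign k K = 1 := by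
  rw [wedgeSign, ← pow_add, ← two_mul, pow_mul]
  simp

/-- Wedging with `dz̄_k` anticommutes with contracting `dz̄_j`. If `j < k`, removing `j` changes the
position of `k`; if `j > k`, inserting `k` changes the position of `j`. -/
lemma wedgeSign_swap {J : Finset (Fin n)} {j k : Fin n} (hj : j ∈ J) (hk : k ∉ J) :
    wedgeSign k (insert k J) * wedgeSign j (insert k J) =
      -(wedgeSign j J * wedgeSign k (insert k (J.erase j))) := by
  have hjk : j ≠ k := fun h => hk (h ▸ hj)
  have h1 : (insert k J).filter (fun i => i < k) = J.filter (fun i => i < k) := by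
    rw [Finset.filter_insert, if_neg (lt_irrefl k)]
  have h2 : (insert k (J.erase j)).filter (fun i => i < k) =
      (J.filter (fun i => i < k)).erase j := by
    ext i
    simp only [Finset.mem_filter, Finset.mem_insert, Finset.mem_erase]
    grind
  simp only [wedgeSign, h1, h2]
  rcases lt_or_gt_of_ne hjk with h | h
  · have h3 : (insert k J).filter (fun i => i < j) = J.filter (fun i => i < j) := by
      rw [Finset.filter_insert, if_neg h.not_gt]
    have h4 : j ∈ J.filter (fun i => i < k) := Finset.mem_filter.2 ⟨hj, h⟩
    rw [h3, ← Finset.card_erase_add_one h4, pow_succ]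
    ring
  · have h3 : (insert k J).filter (fun i => i < j) = insert k (J.filter (fun i => i < j)) := by
      rw [Finset.filter_insert, if_pos h]
    have h4 : j ∉ J.filter (fun i => i < k) := fun h' =>
      lt_asymm h (Finset.mem_filter.1 h').2
    have h5 : k ∉ J.filter (fun i => i < j) := fun h' => hk (Finset.mem_filter.1 h').1
    rw [h3, Finset.erase_eq_of_notMem h4, Finset.card_insert_of_notMem h5, pow_succ]
    ring

/-- The Kohn Laplacian is diagonal: each coefficient of a form with `∂̄_b u = 0` and
`∂̄_b^* u = 0` is a weak solution of a scalar equation. -/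
lemma weak_diagonal (lam : Fin n → ℝ) (q : ℕ) (U : Finset (Fin n) → H n → ℂ)
    (E1 : ∀ K, K.card = q + 1 → ∀ φ, IsTest φ →
      ∑ k ∈ K, wedgeSign k K * ∫ x, U (K.erase k) x * cField lam 1 k φ x ∂vol n = 0)
    (E2 : ∀ I, I.card + 1 = q → ∀ φ, IsTest φ →
      ∑ k ∈ Iᶜ, wedgeSign k (insert k I) *
        ∫ x, U (insert k I) x * cField lam (-1) k φ x ∂vol n = 0)
    (J : Finset (Fin n)) (hJ : J.card = q) (s : Fin n → ℝ)
    (hs : ∀ k, s k = if k ∈ J then -1 else 1) {φ : H n → ℂ} (hφ : IsTest φ) :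
    ∑ k, ∫ x, U J x * cField lam (s k) k (cField lam (-s k) k φ) x ∂vol n = 0 := by
  set a : Fin n → Fin n → ℂ := fun k j =>
    ∫ x, U (insert k (J.erase j)) x * cField lam 1 j (cField lam (-1) k φ) x ∂vol n with ha
  have h1 : ∀ k ∈ Jᶜ, ∫ x, U J x * cField lam (s k) k (cField lam (-s k) k φ) x ∂vol n =
      ∑ j ∈ J, wedgeSign j J * wedgeSign k (insert k (J.erase j)) * a k j := by
    intro k hk
    rw [Finset.mem_compl] at hk
    -- The `dz̄^{J ∪ {k}}` component of `∂̄_b u = 0`, tested with `Z_k φ`, expresses the `k`-th term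
    -- through mixed terms.
    have h := E1 (insert k J) (by rw [Finset.card_insert_of_notMem hk, hJ]) _
      (hφ.cField lam (-1) k)
    rw [Finset.sum_insert hk, Finset.erase_insert hk] at h
    rw [hs k, if_neg hk]
    have e : ∑ j ∈ J, wedgeSign j J * wedgeSign k (insert k (J.erase j)) * a k j =
        -(wedgeSign k (insert k J) * ∑ j ∈ J, wedgeSign j (insert k J) *
          ∫ x, U ((insert k J).erase j) x * cField lam 1 j (cField lam (-1) k φ) x ∂vol n) := by
      rw [Finset.mul_sum, ← Finset.sum_neg_distrib]
      refine Finset.sum_congr rfl fun j hj => ?_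
      have hjk : k ≠ j := fun h => hk (h ▸ hj)
      rw [Finset.erase_insert_of_ne hjk, ← mul_assoc, wedgeSign_swap hj hk]
      ring
    rw [e]
    linear_combination wedgeSign k (insert k J) * h -
      (∫ x, U J x * cField lam 1 k (cField lam (-1) k φ) x ∂vol n) *
        wedgeSign_mul_self k (insert k J)
  have h2 : ∀ j ∈ J, ∫ x, U J x * cField lam (s j) j (cField lam (-s j) j φ) x ∂vol n =
      -∑ k ∈ Jᶜ, wedgeSign j J * wedgeSign k (insert k (J.erase j)) * a k j := by
    intro j hj
    -- The `dz̄^{J \ {j}}` component of `∂̄_b^* u = 0`, tested with `conj Z_j φ`. The fields commute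
    -- for `j ≠ k`, so the same mixed terms appear with the opposite sign.
    have h := E2 (J.erase j) (by rw [Finset.card_erase_add_one hj, hJ]) _ (hφ.cField lam 1 j)
    rw [Finset.compl_erase, Finset.sum_insert (by simpa using hj), Finset.insert_erase hj] at h
    rw [hs j, if_pos hj, neg_neg]
    have e : ∑ k ∈ Jᶜ, wedgeSign j J * wedgeSign k (insert k (J.erase j)) * a k j =
        wedgeSign j J * ∑ k ∈ Jᶜ, wedgeSign k (insert k (J.erase j)) *
          ∫ x, U (insert k (J.erase j)) x * cField lam (-1) k (cField lam 1 j φ) x ∂vol n := by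
      rw [Finset.mul_sum]
      refine Finset.sum_congr rfl fun k hk => ?_
      have hjk : j ≠ k := fun h => Finset.mem_compl.1 hk (h ▸ hj)
      rw [mul_assoc]
      simp only [ha, cField_comm lam 1 (-1) hjk hφ.1]
    rw [e]
    linear_combination wedgeSign j J * h -
      (∫ x, U J x * cField lam (-1) j (cField lam 1 j φ) x ∂vol n) * wedgeSign_mul_self j J
  rw [← Finset.sum_add_sum_compl J, Finset.sum_congr rfl h1, Finset.sum_congr rfl h2,
    Finset.sum_comm (s := Jᶜ), ← Finset.sum_add_distrib]
  simp

/-! ### Test forms, density and the adjoint -/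

lemma memLp_form {q : ℕ} {α : MultiIndex n q → H n → ℂ}
    (hα : ∀ J, Continuous (α J) ∧ HasCompactSupport (α J)) :
    MemLp (fun x => (WithLp.toLp 2 (fun J => α J x) : Fibre n q)) 2 (vol n) := by
  have hc : Continuous (fun x => (WithLp.toLp 2 (fun J => α J x) : Fibre n q)) :=
    (PiLp.continuous_toLp 2 _).comp (continuous_pi fun J => (hα J).1)
  refine hc.memLp_of_hasCompactSupport ?_
  refine HasCompactSupport.intro (isCompact_iUnion fun J => (hα J).2.isCompact) fun x hx => ?_
  ext J
  simp only [Set.mem_iUnion, not_exists] at hx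
  exact image_eq_zero_of_notMem_tsupport (f := α J) (hx J)

/-- The square integrable form with given continuous compactly supported coefficients. -/
def toForm {q : ℕ} (α : MultiIndex n q → H n → ℂ)
    (hα : ∀ J, Continuous (α J) ∧ HasCompactSupport (α J)) : L2Form n q :=
  (memLp_form hα).toLp _

lemma coeff_toForm {q : ℕ} {α : MultiIndex n q → H n → ℂ}
    (hα : ∀ J, Continuous (α J) ∧ HasCompactSupport (α J)) (J : MultiIndex n q) :
    coeff (toForm α hα) J =ᵐ[vol n] α J := by
  filter_upwards [(memLp_form hα).coeFn_toLp] with x hx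
  simp only [coeff, toForm]
  rw [hx]

lemma inner_toForm {q : ℕ} {α : MultiIndex n q → H n → ℂ}
    (hα : ∀ J, Continuous (α J) ∧ HasCompactSupport (α J)) (u : L2Form n q) :
    inner ℂ (toForm α hα) u = ∑ J, ∫ x, coeff u J x * conj (α J x) ∂vol n := by
  rw [L2.inner_def, ← integral_finsetSum]
  · refine integral_congr_ae ?_
    filter_upwards [(memLp_form hα).coeFn_toLp] with x hx
    simp only [toForm]
    rw [hx, PiLp.inner_apply]
    simp [coeff]
  · intro J _
    exact integrable_pair (memLp_coeff u J) (Complex.continuous_conj.comp (hα J).1)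
      ((hα J).2.comp_left (g := conj) (map_zero _))

lemma IsTest.cts {φ : H n → ℂ} (h : IsTest φ) : Continuous φ ∧ HasCompactSupport φ :=
  ⟨h.1.continuous, h.2⟩

lemma isTest_zero : IsTest (0 : H n → ℂ) := ⟨contDiff_const, HasCompactSupport.zero⟩

lemma isTest_dbarSmooth {q : ℕ} (lam : Fin n → ℝ) {α : MultiIndex n q → H n → ℂ}
    (hα : ∀ J, IsTest (α J)) (K : MultiIndex n (q + 1)) : IsTest (dbarSmooth lam α K) := by
  unfold dbarSmooth wedgeSum
  refine Finset.sum_induction _ IsTest (fun f g hf hg => hf.add hg) isTest_zero fun k _ => ?_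
  have h := ((hα (K.erase k)).cField lam 1 k.1).mul_left (f := fun _ => (((-1 : ℤ) ^
    (K.1.filter (fun j => j < k.1)).card : ℤ) : ℂ)) contDiff_const
  rw [← Zbar_eq_cField] at h
  convert h using 1
  funext x
  simp

lemma isWeakDbar_toForm {q : ℕ} (lam : Fin n → ℝ) {α : MultiIndex n q → H n → ℂ}
    (hα : ∀ J, IsTest (α J)) :
    IsWeakDbar lam (toForm α fun J => (hα J).cts)
      (toForm (dbarSmooth lam α) fun K => (isTest_dbarSmooth lam hα K).cts) := by
  intro K φ hφ
  have h1 : toDist (coeff (toForm (dbarSmooth lam α)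
      fun K => (isTest_dbarSmooth lam hα K).cts) K) φ = toDist (dbarSmooth lam α K) φ := by
    refine integral_congr_ae ?_
    filter_upwards [coeff_toForm (fun K => (isTest_dbarSmooth lam hα K).cts) K] with x hx
    rw [hx]
  rw [h1, toDist_dbarSmooth lam (fun J => (hα J).1) K hφ]
  simp only [wedgeSum, Finset.sum_apply, Pi.smul_apply]
  refine Finset.sum_congr rfl fun k _ => ?_
  congr 1
  simp only [distZbar]
  congr 1
  refine integral_congr_ae ?_
  filter_upwards [coeff_toForm (fun J => (hα J).cts) (K.erase k)] with x hx
  rw [hx]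

lemma isTest_single {q : ℕ} (J : MultiIndex n q) {φ : H n → ℂ} (hφ : IsTest φ)
    (I : MultiIndex n q) : IsTest ((Pi.single J φ : MultiIndex n q → H n → ℂ) I) := by
  by_cases h : I = J
  · subst h
    simpa using hφ
  · rw [Pi.single_eq_of_ne h]
    exact isTest_zero

lemma dbar_mem_graph {q : ℕ} (lam : Fin n → ℝ) (u : (dbar lam q).domain) :
    IsWeakDbar lam u.1 (dbar lam q u) :=
  Submodule.mem_graph_toLinearPMap (dbarGraph_unique lam q) u

lemma exists_dbar_eq {q : ℕ} (lam : Fin n → ℝ) {u : L2Form n q} {v : L2Form n (q + 1)}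
    (h : IsWeakDbar lam u v) : ∃ hu : u ∈ (dbar lam q).domain, dbar lam q ⟨u, hu⟩ = v := by
  have h1 : (u, v) ∈ (dbar lam q).graph := by
    rw [dbar, Submodule.toLinearPMap_graph_eq _ (dbarGraph_unique lam q)]
    exact h
  obtain ⟨y, hy, hv⟩ := (LinearPMap.mem_graph_iff _).1 h1
  simp only at hy hv
  subst hy
  exact ⟨y.2, hv⟩

lemma eq_zero_of_coeff {q : ℕ} {u : L2Form n q} (h : ∀ J, ∀ᵐ x ∂vol n, coeff u J x = 0) :
    u = 0 := by
  rw [Lp.eq_zero_iff_ae_eq_zero]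
  filter_upwards [ae_all_iff.2 h] with x hx
  ext J
  exact hx J

/-- Forms with a single test coefficient lie in the domain and detect every coefficient. The adjoint
identity for `dbarStar` rests on this density. -/
lemma dense_dbar_domain (lam : Fin n → ℝ) (q : ℕ) :
    Dense ((dbar lam q).domain : Set (L2Form n q)) := by
  rw [Submodule.dense_iff_topologicalClosure_eq_top, Submodule.topologicalClosure_eq_top_iff,
    Submodule.eq_bot_iff]
  intro u hu
  refine eq_zero_of_coeff fun J => ?_
  refine ae_eq_zero_of_integral_contDiff_smul_eq_zero
      ((memLp_coeff u J).locallyIntegrable (by norm_num)) ?_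
  intro g hg hgs
  have ht : IsTest (fun x => (g x : ℂ)) :=
    ⟨Complex.ofRealCLM.contDiff.comp hg, hgs.comp_left (g := Complex.ofReal) (by simp)⟩
  obtain ⟨hd, -⟩ := exists_dbar_eq lam (isWeakDbar_toForm lam (isTest_single J ht))
  have h0 := (Submodule.mem_orthogonal _ _).1 hu _ hd
  rw [inner_toForm, Finset.sum_eq_single J] at h0
  · rw [← h0]
    refine integral_congr_ae (Filter.Eventually.of_forall fun x => ?_)
    simp [mul_comm]
  · intro I _ hI
    simp [Pi.single_eq_of_ne hI]
  · simp

lemma mem_pcomp {E F G : Type*} [AddCommGroup E] [Module ℂ E] [AddCommGroup F] [Module ℂ F]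
    [AddCommGroup G] [Module ℂ G] (g : F →ₗ.[ℂ] G) (f : E →ₗ.[ℂ] F) (x : (pcomp g f).domain) :
    ∃ (hx : x.1 ∈ f.domain) (hy : f ⟨x.1, hx⟩ ∈ g.domain),
      pcomp g f x = g ⟨f ⟨x.1, hx⟩, hy⟩ := by
  obtain ⟨⟨y, hy⟩, hy', hxy⟩ := x.2.1
  simp only [Submodule.subtype_apply] at hxy
  have hx : x.1 ∈ f.domain := x.2.2
  subst hxy
  exact ⟨hx, hy', rfl⟩

lemma inner_dbarStar_dbar (lam : Fin n → ℝ) (q : ℕ) (u : (dbar lam q).domain)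
    (h : dbar lam q u ∈ (dbarStar lam q).domain) :
    inner ℂ (dbarStar lam q ⟨dbar lam q u, h⟩) u.1 = (‖dbar lam q u‖ : ℂ) ^ 2 := by
  have := LinearPMap.adjoint_isFormalAdjoint (dense_dbar_domain lam q) ⟨dbar lam q u, h⟩ u
  exact this.trans (inner_self_eq_norm_sq_to_K _)

lemma inner_dbar_dbarStar (lam : Fin n → ℝ) (q : ℕ) (u : (dbarStar lam q).domain)
    (h : dbarStar lam q u ∈ (dbar lam q).domain) :
    inner ℂ (dbar lam q ⟨dbarStar lam q u, h⟩) u.1 = (‖dbarStar lam q u‖ : ℂ) ^ 2 := by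
  have := (LinearPMap.adjoint_isFormalAdjoint (dense_dbar_domain lam q)).symm
    ⟨dbarStar lam q u, h⟩ u
  rw [this]
  exact inner_self_eq_norm_sq_to_K _

lemma isWeakDbar_zero_of_dbar {q : ℕ} (lam : Fin n → ℝ) (u : (dbar lam q).domain)
    (h : dbar lam q u = 0) : IsWeakDbar lam u.1 0 :=
  h ▸ dbar_mem_graph lam u

lemma harmonic_zero (lam : Fin n → ℝ) {u : L2Form n 0} (hu : u ∈ harmonicSpace lam 0) :
    IsWeakDbar lam u 0 := by
  obtain ⟨v, hv, rfl⟩ := hu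
  obtain ⟨hx, hy, h⟩ := mem_pcomp (dbarStar lam 0) (dbar lam 0) v
  have h0 : pcomp (dbarStar lam 0) (dbar lam 0) v = 0 := hv
  rw [h] at h0
  have h1 := inner_dbarStar_dbar lam 0 ⟨v.1, hx⟩ hy
  rw [h0, inner_zero_left, eq_comm, sq_eq_zero_iff, Complex.ofReal_eq_zero, norm_eq_zero] at h1
  exact isWeakDbar_zero_of_dbar lam ⟨v.1, hx⟩ h1

/-- The pairing of `□_b u` with `u` is `‖∂̄_b^* u‖² + ‖∂̄_b u‖²`. The equation `∂̄_b^* u = 0` is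
kept as orthogonality to the range of `∂̄_b`, so no formula for `∂̄_b^*` is needed. -/
lemma harmonic_succ (lam : Fin n → ℝ) (q : ℕ) {u : L2Form n (q + 1)}
    (hu : u ∈ harmonicSpace lam (q + 1)) :
    IsWeakDbar lam u 0 ∧ ∀ (v : L2Form n q) (w : L2Form n (q + 1)), IsWeakDbar lam v w →
      inner ℂ w u = 0 := by
  obtain ⟨v, hv, rfl⟩ := hu
  obtain ⟨hx, hy, h⟩ := mem_pcomp (dbar lam q) (dbarStar lam q) ⟨v.1, v.2.1⟩
  obtain ⟨hx', hy', h'⟩ := mem_pcomp (dbarStar lam (q + 1)) (dbar lam (q + 1)) ⟨v.1, v.2.2⟩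
  have h0 : pcomp (dbar lam q) (dbarStar lam q) ⟨v.1, v.2.1⟩ +
    pcomp (dbarStar lam (q + 1)) (dbar lam (q + 1)) ⟨v.1, v.2.2⟩ = 0 := hv
  have h1 := congrArg (fun z => inner ℂ z v.1) h0
  simp only [h, h', inner_add_left, inner_zero_left] at h1
  rw [inner_dbarStar_dbar lam (q + 1) ⟨v.1, hx'⟩ hy',
    inner_dbar_dbarStar lam q ⟨v.1, hx⟩ hy] at h1
  norm_cast at h1
  rw [add_eq_zero_iff_of_nonneg (by positivity) (by positivity)] at h1
  simp only [ne_eq, OfNat.ofNat_ne_zero, not_false_eq_true, pow_eq_zero_iff, norm_eq_zero] at h1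
  refine ⟨isWeakDbar_zero_of_dbar lam ⟨v.1, hx'⟩ h1.2, fun a b hab => ?_⟩
  obtain ⟨ha, rfl⟩ := exists_dbar_eq lam hab
  have h2 := (LinearPMap.adjoint_isFormalAdjoint (dense_dbar_domain lam q)).symm
    ⟨a, ha⟩ ⟨v.1, hx⟩
  have h3 : (dbar lam q).adjoint ⟨v.1, hx⟩ = 0 := h1.1
  rw [h3, inner_zero_right] at h2
  exact h2

/-! ### Scalar equations for the coefficients of a harmonic form -/

/-- The coefficients of a form, indexed by arbitrary sets. -/
def coeffSet {q : ℕ} (u : L2Form n q) (S : Finset (Fin n)) : H n → ℂ :=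
  if h : S.card = q then coeff u ⟨S, h⟩ else 0

lemma coeffSet_val {q : ℕ} (u : L2Form n q) (J : MultiIndex n q) :
    coeffSet u J.1 = coeff u J := by
  simp [coeffSet, J.2]

lemma sum_of_isWeakDbar_zero (lam : Fin n → ℝ) {q : ℕ} {u : L2Form n q}
    (h : IsWeakDbar lam u 0) (K : Finset (Fin n)) (hK : K.card = q + 1) {φ : H n → ℂ}
    (hφ : IsTest φ) :
    ∑ k ∈ K, wedgeSign k K * ∫ x, coeffSet u (K.erase k) x * cField lam 1 k φ x ∂vol n = 0 := by
  have h1 := h ⟨K, hK⟩ φ hφ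
  have h2 : toDist (coeff (0 : L2Form n (q + 1)) ⟨K, hK⟩) φ = 0 := by
    simpa [toDist] using integral_coeff_smul 0 (0 : L2Form n (q + 1)) ⟨K, hK⟩ φ
  rw [h2] at h1
  rw [← Finset.sum_coe_sort, ← neg_eq_zero, ← h1, ← Finset.sum_neg_distrib]
  simp only [wedgeSum, Finset.sum_apply, Pi.smul_apply]
  refine Finset.sum_congr rfl fun k _ => ?_
  have h3 := coeffSet_val u (MultiIndex.erase ⟨K, hK⟩ k)
  simp only [MultiIndex.erase] at h3
  rw [h3, distZbar, Zbar_eq_cField, wedgeSign, zsmul_eq_mul]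
  push_cast
  rw [mul_neg]
  rfl

/-- Orthogonality to `∂̄_b (conj φ dz̄^I)`. The conjugation in the inner product turns `conj Z_k
(conj φ)` into `Z_k φ`. -/
lemma sum_of_inner_eq_zero (lam : Fin n → ℝ) {q : ℕ} {u : L2Form n (q + 1)}
    (h : ∀ (v : L2Form n q) (w : L2Form n (q + 1)), IsWeakDbar lam v w → inner ℂ w u = 0)
    (I : Finset (Fin n)) (hI : I.card = q) {φ : H n → ℂ} (hφ : IsTest φ) :
    ∑ k ∈ Iᶜ, wedgeSign k (insert k I) *
      ∫ x, coeffSet u (insert k I) x * cField lam (-1) k φ x ∂vol n = 0 := by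
  have hcφ : IsTest (fun x => conj (φ x)) :=
    ⟨(Complex.conjCLE : ℂ →L[ℝ] ℂ).contDiff.comp hφ.1, hφ.2.comp_left (g := conj) (map_zero _)⟩
  set α : MultiIndex n q → H n → ℂ := Pi.single ⟨I, hI⟩ (fun x => conj (φ x)) with hα
  have hαt : ∀ J, IsTest (α J) := isTest_single ⟨I, hI⟩ hcφ
  have h0 := h _ _ (isWeakDbar_toForm lam hαt)
  rw [inner_toForm] at h0
  set F : Fin n → Finset (Fin n) → ℂ := fun k K =>
    wedgeSign k K * ∫ x, coeffSet u K x * cField lam (-1) k φ x ∂vol n with hF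
  have hD : ∀ (K : MultiIndex n (q + 1)) (x : H n), conj (dbarSmooth lam α K x) =
      ∑ k ∈ K.1, if K.1.erase k = I then wedgeSign k K.1 * cField lam (-1) k φ x else 0 := by
    intro K x
    rw [← Finset.sum_coe_sort K.1]
    simp only [dbarSmooth, wedgeSum, Finset.sum_apply, Pi.smul_apply, map_sum]
    refine Finset.sum_congr rfl fun k _ => ?_
    by_cases hk : K.1.erase k = I
    · have h1 : α (K.erase k) = fun x => conj (φ x) := by
        have : K.erase k = ⟨I, hI⟩ := Subtype.ext hk
        rw [this, hα, Pi.single_eq_same]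
      rw [if_pos hk, h1, Zbar_eq_cField, cField_conj lam 1 k.1 hφ.1, zsmul_eq_mul, map_mul,
        Complex.conj_conj, wedgeSign]
      simp
    · have h1 : α (K.erase k) = 0 :=
        Pi.single_eq_of_ne (fun h' => hk (congrArg Subtype.val h')) _
      rw [if_neg hk, h1, Zbar_eq_cField]
      simp [cField, lv]
  have hint : ∀ K : MultiIndex n (q + 1),
      ∫ x, coeff u K x * conj (dbarSmooth lam α K x) ∂vol n =
        ∑ k, if k ∈ K.1 ∧ K.1.erase k = I then F k K.1 else 0 := by
    intro K
    simp only [hD, Finset.mul_sum]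
    rw [integral_finsetSum]
    · simp only [ite_and]
      rw [Finset.sum_ite_mem, Finset.univ_inter]
      refine Finset.sum_congr rfl fun k _ => ?_
      split_ifs with hk
      · simp only [hF, coeffSet_val, mul_left_comm _ (wedgeSign k K.1), integral_const_mul]
      · simp
    · intro k _
      split_ifs with hk
      · have ht := (hφ.cField lam (-1) k).mul_left (f := fun _ => wedgeSign k K.1) contDiff_const
        exact integrable_pair (memLp_coeff u K) ht.1.continuous ht.2
      · simp
  simp only [hint] at h0
  rw [Finset.sum_comm] at h0
  -- For given `k`, the only `K` containing `k` with `K \ {k} = I` is `I ∪ {k}`, which requires `k ∉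
  -- I`.
  have hone : ∀ k, (∑ K : MultiIndex n (q + 1), if k ∈ K.1 ∧ K.1.erase k = I then F k K.1 else 0) =
      if k ∈ Iᶜ then F k (insert k I) else 0 := by
    intro k
    by_cases hk : k ∈ I
    · rw [if_neg (by simpa using hk)]
      refine Finset.sum_eq_zero fun K _ => if_neg ?_
      rintro ⟨-, rfl⟩
      simp at hk
    · rw [if_pos (by simpa using hk), Finset.sum_eq_single
        ⟨insert k I, by rw [Finset.card_insert_of_notMem hk, hI]⟩]
      · simp [Finset.erase_insert hk]
      · intro K _ hK
        refine if_neg ?_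
        rintro ⟨h1, rfl⟩
        exact hK (Subtype.ext (Finset.insert_erase h1).symm)
      · simp
  simp only [hone] at h0
  rwa [Finset.sum_ite_mem, Finset.univ_inter] at h0

/-- The coefficients of a harmonic form are weak solutions of scalar equations. -/
lemma harmonic_weak (lam : Fin n → ℝ) {q : ℕ} {u : L2Form n q} (hu : u ∈ harmonicSpace lam q)
    (J : MultiIndex n q) {φ : H n → ℂ} (hφ : IsTest φ) (s : Fin n → ℝ)
    (hs : ∀ k, s k = if k ∈ J.1 then -1 else 1) :
    ∑ k, ∫ x, coeff u J x * cField lam (s k) k (cField lam (-s k) k φ) x ∂vol n = 0 := by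
  rw [← coeffSet_val]
  cases q with
  | zero =>
    exact weak_diagonal lam 0 (coeffSet u)
      (fun K hK φ hφ => sum_of_isWeakDbar_zero lam (harmonic_zero lam hu) K hK hφ)
      (fun I hI => absurd hI (Nat.succ_ne_zero _)) J.1 J.2 s hs hφ
  | succ q =>
    obtain ⟨h1, h2⟩ := harmonic_succ lam q hu
    exact weak_diagonal lam (q + 1) (coeffSet u)
      (fun K hK φ hφ => sum_of_isWeakDbar_zero lam h1 K hK hφ)
      (fun I hI φ hφ => sum_of_inner_eq_zero lam h2 I (Nat.succ_injective hI) hφ) J.1 J.2 s hs hφ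

lemma harmonicSpace_eq_bot (lam : Fin n → ℝ) (q : ℕ)
    (h : ∀ J : MultiIndex n q, ∀ s : Fin n → ℝ, (∀ k, s k = if k ∈ J.1 then -1 else 1) →
      (∃ j, lam j = 0) ∨ ∃ k l, 0 < s k * lam k ∧ s l * lam l < 0) :
    harmonicSpace lam q = ⊥ := by
  rw [Submodule.eq_bot_iff]
  intro u hu
  refine eq_zero_of_coeff fun J => ?_
  exact ae_eq_zero_of_weak lam (fun k => if k ∈ J.1 then -1 else 1) (memLp_coeff u J)
    (fun φ hφ => harmonic_weak lam hu J hφ _ fun _ => rfl) (h J _ fun _ => rfl)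

end Heisenberg

end

/-! ### Counting signs -/

theorem theorem1p1 (n : ℕ) (lam : Fin n → ℝ) (q : ℕ) :
    ((∃ j, lam j = 0) → Heisenberg.harmonicSpace lam q = ⊥) ∧
    ((∀ j, lam j ≠ 0) →
      q ∉ ({(Finset.univ.filter (fun j => lam j < 0)).card,
            (Finset.univ.filter (fun j => 0 < lam j)).card} : Set ℕ) →
      Heisenberg.harmonicSpace lam q = ⊥) := by
  refine ⟨fun h => Heisenberg.harmonicSpace_eq_bot lam q fun _ _ _ => Or.inl h,
    fun hne hq => Heisenberg.harmonicSpace_eq_bot lam q fun J s hs => Or.inr ?_⟩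
  rw [Set.mem_insert_iff, Set.mem_singleton_iff, not_or] at hq
  have hpos : ∃ k, 0 < s k * lam k := by
    -- Otherwise every `s_k λ_k` is negative and `J` is exactly the set of positive `λ_k`, forcing
    -- `q = n_+`.
    by_contra! hk
    refine hq.2 (J.2.symm.trans (congrArg Finset.card ?_))
    ext k
    have h1 := hk k
    rw [hs k] at h1
    simp only [Finset.mem_filter, Finset.mem_univ, true_and]
    split_ifs at h1 with hkJ
    · exact iff_of_true hkJ (lt_of_le_of_ne (by linarith) (hne k).symm)
    · exact iff_of_false hkJ (by linarith)
  have hneg : ∃ l, s l * lam l < 0 := by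
    -- Otherwise `J` is exactly the set of negative `λ_k`, forcing `q = n_-`.
    by_contra! hk
    refine hq.1 (J.2.symm.trans (congrArg Finset.card ?_))
    ext k
    have h1 := hk k
    rw [hs k] at h1
    simp only [Finset.mem_filter, Finset.mem_univ, true_and]
    split_ifs at h1 with hkJ
    · exact iff_of_true hkJ (lt_of_le_of_ne (by linarith) (hne k))
    · exact iff_of_false hkJ (by linarith)
  obtain ⟨k, hk⟩ := hpos
  obtain ⟨l, hl⟩ := hneg
  exact ⟨k, l, hk, hl⟩
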